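/- **Setting.** Let $\mathbb G=(\mathbb R^n,\circ,\{\delta_R\}_{R>0})$ be a homogeneous Carnot group: $\mathbb R^n=\mathbb R^{m_1}\times\dots\times\mathbb R^{m_s}$, $\circ$ is a Lie group law with unit $0$, the dilations $\delta_R(x)=(Rx^{(1)},R^2x^{(2)},\dots,R^sx^{(s)})$ are group automorphisms, and the left-invariant vector fields $X_1,\dots,X_{m_1}$ with $X_j(0)=\partial_j$ generate, through iterated Lie brackets, the whole tangent space at every point. (Every Carnot group is isomorphic to a group of this form.) Let $\nabla_0u=\sum_{j\le m_1}X_j(u)X_j$ be the horizontal gradient, with $X_1,\dots,X_{m_1}$ orthonormal. Let $r:\mathbb G\to[0,\infty)$ be a continuous symmetric homogeneous norm: $r(x)>0$ iff $x\ne0$, $r(\delta_Rx)=R\,r(x)$ for $R>0$, and $r(x^{-1})=r(x)$. A function $u:U\subset\mathbb G\to\mathbb R$ is Lipschitz if $u(x)-u(y)\le C\,r(x^{-1}\circ y)$ on $U$ for some $C>0$. $\mathrm{Lip}_{\rm loc}(\mathbb G)$ denotes the functions that are Lipschitz near each point, and $\mathrm{Lip}_c(\mathbb G)$ the Lipschitz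 functions with compact support; $X_ju$ denotes the weak derivative. A function $u\in \mathrm{Lip}_{\rm loc}(\mathbb G)$ is a weak solution of $\Delta_{\mathbb G}^\varphi u\ge b(x)f(u)l(|\nabla_0u|)$ on $\mathbb G$ if $$\int_{\mathbb G}\frac{\varphi(|\nabla_0u|)}{|\nabla_0u|}\langle\nabla_0u,\nabla_0\phi\rangle\,dx\le-\int_{\mathbb G}b(x)f(u)l(|\nabla_0u|)\,\phi\,dx\qquad\text{for all }0\le\phi\in\mathrm{Lip}_c(\mathbb G)$$ (the first integrand being $0$ where $\nabla_0u=0$), and of the equation $\Delta_{\mathbb G}^\varphi u= b(x)f(u)l(|\nabla_0u|)$ if equality holds for all such $\phi$. Write $u^*=\sup_{\mathbb G}u$ and $u_*=\inf_{\mathbb G}u$. **Hypotheses.** Let $p>1$ and let $\varphi\in C^0([0,\infty))$ be weakly $p$-coercive: $\varphi(0)=0$, $\varphi>0$ on $(0,\infty)$, and $\varphi(t)\le C't^{p-1}$ on $(0,\infty)$ for some $C'>0$. Let $b\in C^0(\mathbb G)$ with $b>0$, $f\in C^0(\mathbb R)$, and $l\in C^0([0,\infty))$ with $l(t)>0$ for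 $t>0$. Let $\mu,\chi,\omega\in\mathbb R$ satisfy $$0\le\chi\le p-1,\qquad\mu<p-\chi,\qquad\omega>p-1-\chi,$$ and suppose that, for some constant $C>0$, $$b\ge C(1+r)^{-\mu}\ \text{ on }\mathbb G,\qquad l(t)\ge C\,\frac{\varphi(t)}{t^{p-1-\chi}}\ \text{ for all }t>0.$$ **Theorem.** 1. Suppose that $f(t)\ge Ct^\omega$ for all $t$ large enough. Then every weak solution $u\in\mathrm{Lip}_{\rm loc}(\mathbb G)$ of $\Delta_{\mathbb G}^\varphi u\ge b(x)f(u)l(|\nabla_0u|)$ on $\mathbb G$ satisfies $u^*<+\infty$, and - if $l(0)>0$, then $f(u^*)\le0$; - if $l(0)=0$, then $f(u^*)\le0$ unless $u$ is constant. 2. Suppose instead that $tf(t)\ge C|t|^{\omega+1}$ for all $|t|$ large enough. Then every weak solution $u\in\mathrm{Lip}_{\rm loc}(\mathbb G)$ of $\Delta_{\mathbb G}^\varphi u= b(x)f(u)l(|\nabla_0u|)$ on $\mathbb G$ is bounded, $u\in L^\infty(\mathbb G)$, and - if $l(0)>0$, then $f(u^*)\le0\le f(u_*)$; - if $l(0)=0$,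 then $f(u^*)\le0\le f(u_*)$ unless $u$ is constant. -/

import Mathlib

open MeasureTheory

noncomputable section

/-- Anisotropic dilation `δ_R` of `ℝⁿ`: the coordinate `x i`, of weight `w i`, is multiplied by
`R ^ (w i)`. -/
def anisoDilation {n : ℕ} (w : Fin n → ℕ) (R : ℝ) (x : Fin n → ℝ) : Fin n → ℝ :=
  fun i => R ^ w i * x i

/-- The left-invariant vector field, for a product `mul` on `ℝⁿ` with unit `0`, whose value at `0`
is the `j`-th coordinate vector. -/
def leftInvField {n : ℕ} (mul : (Fin n → ℝ) → (Fin n → ℝ) → (Fin n → ℝ)) (j : Fin n) :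
    (Fin n → ℝ) → (Fin n → ℝ) :=
  fun x => fderiv ℝ (fun y => mul x y) 0 (Pi.single j 1)

/-- Iterated Lie brackets of the vector fields belonging to a set `S`. -/
inductive IsIteratedBracket {n : ℕ} (S : Set ((Fin n → ℝ) → (Fin n → ℝ))) :
    ((Fin n → ℝ) → (Fin n → ℝ)) → Prop
  | base (V : (Fin n → ℝ) → (Fin n → ℝ)) (hV : V ∈ S) : IsIteratedBracket S V
  | bracket (V W : (Fin n → ℝ) → (Fin n → ℝ)) (hV : IsIteratedBracket S V)
      (hW : IsIteratedBracket S W) : IsIteratedBracket S (VectorField.lieBracket ℝ V W)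

/-- A homogeneous Carnot group structure on `ℝⁿ = ℝ^{m₁} × ⋯ × ℝ^{m_s}`. The coordinate `x i`
belongs to the layer `ℝ^{m_k}` with `k = weight i`. -/
structure HomogeneousCarnotGroup (n : ℕ) where
  /-- index of the layer of each coordinate; layers are numbered from `1` and come in order -/
  weight : Fin n → ℕ
  weight_pos : ∀ i, 1 ≤ weight i
  weight_mono : Monotone weight
  /-- the group law -/
  mul : (Fin n → ℝ) → (Fin n → ℝ) → (Fin n → ℝ)
  /-- the inversion -/
  inv : (Fin n → ℝ) → (Fin n → ℝ)
  mul_assoc : ∀ x y z, mul (mul x y) z = mul x (mul y z)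
  zero_mul : ∀ x, mul 0 x = x
  mul_zero : ∀ x, mul x 0 = x
  inv_mul : ∀ x, mul (inv x) x = 0
  contDiff_mul : ContDiff ℝ (⊤ : ℕ∞) (fun z : (Fin n → ℝ) × (Fin n → ℝ) => mul z.1 z.2)
  contDiff_inv : ContDiff ℝ (⊤ : ℕ∞) inv
  /-- dilations are group automorphisms -/
  dilation_mul : ∀ R : ℝ, 0 < R → ∀ x y,
    anisoDilation weight R (mul x y) = mul (anisoDilation weight R x) (anisoDilation weight R y)
  /-- the left-invariant fields of the first layer generate the tangent space at every point -/
  bracket_generating : ∀ x, Submodule.span ℝ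
    {v | ∃ V, IsIteratedBracket {Y | ∃ j, weight j = 1 ∧ Y = leftInvField mul j} V ∧ V x = v} = ⊤

namespace HomogeneousCarnotGroup

variable {n : ℕ} (G : HomogeneousCarnotGroup n)

/-- Indices of the coordinates of the first layer. -/
abbrev HIndex : Type := {j : Fin n // G.weight j = 1}

/-- The horizontal left-invariant vector field `X_j`. -/
def X (j : G.HIndex) : (Fin n → ℝ) → (Fin n → ℝ) := leftInvField G.mul j.1

/-- Symmetric homogeneous norms on `G`. -/
structure IsHomogeneousNorm (r : (Fin n → ℝ) → ℝ) : Prop where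
  continuous : Continuous r
  nonneg : ∀ x, 0 ≤ r x
  pos_iff : ∀ x, 0 < r x ↔ x ≠ 0
  dilation : ∀ R : ℝ, 0 < R → ∀ x, r (anisoDilation G.weight R x) = R * r x
  symm : ∀ x, r (G.inv x) = r x

/-- `u` is Lipschitz on `U` with respect to the homogeneous norm `r`. -/
def IsLipOn (r : (Fin n → ℝ) → ℝ) (u : (Fin n → ℝ) → ℝ) (U : Set (Fin n → ℝ)) : Prop :=
  ∃ C : ℝ, 0 < C ∧ ∀ x ∈ U, ∀ y ∈ U, u x - u y ≤ C * r (G.mul (G.inv x) y)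

/-- `u ∈ Lip_loc(G)`. -/
def IsLipLoc (r : (Fin n → ℝ) → ℝ) (u : (Fin n → ℝ) → ℝ) : Prop :=
  ∀ x, ∃ U ∈ nhds x, G.IsLipOn r u U

/-- `η ∈ Lip_c(G)`. -/
def IsLipC (r : (Fin n → ℝ) → ℝ) (η : (Fin n → ℝ) → ℝ) : Prop :=
  G.IsLipOn r η Set.univ ∧ HasCompactSupport η

/-- `g` is a weak derivative `X_j u`. The field `X_j` has zero divergence with respect to the
Lebesgue measure, so that its formal adjoint is `-X_j`. -/
def IsWeakDeriv (j : G.HIndex) (u g : (Fin n → ℝ) → ℝ) : Prop :=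
  LocallyIntegrable u ∧ LocallyIntegrable g ∧
    ∀ ψ : (Fin n → ℝ) → ℝ, ContDiff ℝ (⊤ : ℕ∞) ψ → HasCompactSupport ψ →
      ∫ x, u x * fderiv ℝ ψ x (G.X j x) = - ∫ x, g x * ψ x

open Classical in
/-- The weak derivative `X_j u` (unique up to a null set; `0` if there is none). -/
def weakDeriv (j : G.HIndex) (u : (Fin n → ℝ) → ℝ) : (Fin n → ℝ) → ℝ :=
  if h : ∃ g, G.IsWeakDeriv j u g then h.choose else 0

/-- The horizontal gradient `∇₀ u`, written in the orthonormal frame `(X_j)`. -/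
def hgrad (u : (Fin n → ℝ) → ℝ) (x : Fin n → ℝ) : EuclideanSpace ℝ G.HIndex :=
  WithLp.toLp 2 (fun j => G.weakDeriv j u x)

/-- `∫ φ(|∇₀u|)/|∇₀u| ⟨∇₀u, ∇₀η⟩ dx`. -/
def energyPairing (φ : ℝ → ℝ) (u η : (Fin n → ℝ) → ℝ) : ℝ :=
  ∫ x, φ ‖G.hgrad u x‖ / ‖G.hgrad u x‖ * inner ℝ (G.hgrad u x) (G.hgrad η x)

/-- `∫ b f(u) l(|∇₀u|) η dx`. -/
def sourcePairing (b : (Fin n → ℝ) → ℝ) (f l : ℝ → ℝ) (u η : (Fin n → ℝ) → ℝ) : ℝ :=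
  ∫ x, b x * f (u x) * l ‖G.hgrad u x‖ * η x

/-- `u ∈ Lip_loc(G)` is a weak solution of `Δ^φ u ≥ b f(u) l(|∇₀u|)` on `G`. -/
def IsWeakSubsolution (r : (Fin n → ℝ) → ℝ) (φ : ℝ → ℝ) (b : (Fin n → ℝ) → ℝ) (f l : ℝ → ℝ)
    (u : (Fin n → ℝ) → ℝ) : Prop :=
  G.IsLipLoc r u ∧ ∀ η : (Fin n → ℝ) → ℝ, G.IsLipC r η → (∀ x, 0 ≤ η x) →
    G.energyPairing φ u η ≤ - G.sourcePairing b f l u η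

/-- `u ∈ Lip_loc(G)` is a weak solution of `Δ^φ u = b f(u) l(|∇₀u|)` on `G`. -/
def IsWeakSolution (r : (Fin n → ℝ) → ℝ) (φ : ℝ → ℝ) (b : (Fin n → ℝ) → ℝ) (f l : ℝ → ℝ)
    (u : (Fin n → ℝ) → ℝ) : Prop :=
  G.IsLipLoc r u ∧ ∀ η : (Fin n → ℝ) → ℝ, G.IsLipC r η → (∀ x, 0 ≤ η x) →
    G.energyPairing φ u η = - G.sourcePairing b f l u η

end HomogeneousCarnotGroup

/-- Weak `p`-coercivity (WpC) of the `φ`-Laplacian. Only the values of `φ` on `[0,∞)` matter. -/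
structure IsWeaklyCoercive (φ : ℝ → ℝ) (p : ℝ) : Prop where
  continuousOn : ContinuousOn φ (Set.Ici 0)
  zero : φ 0 = 0
  pos : ∀ t, 0 < t → 0 < φ t
  growth : ∃ C : ℝ, 0 < C ∧ ∀ t, 0 < t → φ t ≤ C * t ^ (p - 1)

end

/-!
The proof is by test functions of the form `ψ ^ k * (u - γ)₊ ^ q`, with large exponents `k` and
`q`.

*Alternative.* Suppose that `f(u) ≥ c (u - γ) ^ ω` wherever `u > γ`. Put `v = (u - γ)₊`, `t =
|∇₀u|`, and let `ψ` be a cut-off function equal to `1` at scale `R`, so that `|∇₀ψ| ≲ 1 / R`.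
Testing the inequality gives a diffusion term `ψ ^ k v ^ (q - 1) φ(t) t`, a source term bounded
below by a multiple of `R ^ (-μ) v ^ ω φ(t) t ^ (χ + 1 - p) ψ ^ k v ^ q`, and, on the other side,
the term `k ψ ^ (k - 1) v ^ q φ(t) |∇₀ψ|`. At points where neither of the first two dominates the
third, `ψ t ≲ v / R` and `v ^ (ω - (p - 1 - χ)) ψ ^ (p - χ) ≲ R ^ (μ + χ - p)`. Since `φ(t) ≲ t ^
(p - 1)`, the third term is there at most a power `R ^ (-D)`, with `D` as large as desired
(`exists_cutoff_absorption`). As balls have polynomial volume, `R → ∞` gives `∇₀ (v ^ q) = 0`, so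
that `v ^ q` is constant: either `u ≤ γ` or `u` is constant (`IsWeakSubsolution.le_or_eq_const`).

*Conclusion.* The growth `f(t) ≥ C t ^ ω` puts every large `γ` in this situation, so `u` is
bounded above. If `f(sup u) > 0`, then every `γ` slightly below `sup u` is in this situation too,
because `v` is bounded and `ω > 0`; hence `u` is constant, which is excluded if `l(0) > 0` by
testing once more. The second part follows by applying the first to `u` and to `-u`.

*Calculus on the group.* The Jacobian of a right translation is invariant under the dilations and
equals `1` at the unit, so right translations preserve the Lebesgue measure. The field `X_j` has a
one-parameter subgroup `expCurve`, along which a locally Lipschitz function is differentiable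
almost everywhere; this pointwise derivative is the weak derivative (`IsLipLoc.weakDeriv_ae_eq`),
and the chain and product rules are then pointwise. A locally Lipschitz function with vanishing
horizontal gradient is constant, since its group convolutions are smooth and annihilated by the
`X_j`, hence by all their brackets (`IsLipLoc.eq_of_curveDeriv_ae_zero`).
-/

section CarnotLiouville

open Filter Topology Set

/-! ### Dilations -/

section Dilation

variable {n : ℕ} (w : Fin n → ℕ)

lemma anisoDilation_one (x : Fin n → ℝ) : anisoDilation w 1 x = x := by
  ext i; simp [anisoDilation]

lemma anisoDilation_anisoDilation (R S : ℝ) (x : Fin n → ℝ) :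
    anisoDilation w R (anisoDilation w S x) = anisoDilation w (R * S) x := by
  ext i; simp [anisoDilation, mul_pow, mul_assoc]

lemma anisoDilation_inv_cancel {R : ℝ} (hR : R ≠ 0) (x : Fin n → ℝ) :
    anisoDilation w R (anisoDilation w R⁻¹ x) = x := by
  rw [anisoDilation_anisoDilation, mul_inv_cancel₀ hR, anisoDilation_one]

lemma anisoDilation_zero_right (R : ℝ) : anisoDilation w R 0 = 0 := by
  ext i; simp [anisoDilation]

lemma anisoDilation_zero_left (hw : ∀ i, 1 ≤ w i) (x : Fin n → ℝ) : anisoDilation w 0 x = 0 := by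
  ext i; have := hw i; simp [anisoDilation]; left; omega

lemma continuous_anisoDilation :
    Continuous fun p : ℝ × (Fin n → ℝ) => anisoDilation w p.1 p.2 := by
  unfold anisoDilation; fun_prop

/-- The dilation `δ_R` as a continuous linear map. -/
def anisoDilationCLM (R : ℝ) : (Fin n → ℝ) →L[ℝ] (Fin n → ℝ) :=
  ContinuousLinearMap.pi fun i => (R ^ w i) • ContinuousLinearMap.proj i

@[simp] lemma anisoDilationCLM_apply (R : ℝ) (x : Fin n → ℝ) :
    anisoDilationCLM w R x = anisoDilation w R x := by
  ext i; simp [anisoDilationCLM, anisoDilation]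

lemma anisoDilation_single {j : Fin n} (hj : w j = 1) (R : ℝ) :
    anisoDilation w R (Pi.single j 1) = R • Pi.single j 1 := by
  ext i
  by_cases h : i = j
  · subst h; simp [anisoDilation, hj]
  · simp [anisoDilation, h]

lemma det_anisoDilationCLM_ne_zero {R : ℝ} (hR : R ≠ 0) : (anisoDilationCLM w R).det ≠ 0 := by
  intro h
  have h1 : (anisoDilationCLM w R).comp (anisoDilationCLM w R⁻¹) =
      ContinuousLinearMap.id ℝ (Fin n → ℝ) := by
    ext1 x; simp [anisoDilation_inv_cancel w hR]
  have h2 : ((anisoDilationCLM w R).comp (anisoDilationCLM w R⁻¹)).det = 1 := by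
    rw [h1]; exact LinearMap.det_id
  have h3 : ((anisoDilationCLM w R).comp (anisoDilationCLM w R⁻¹)).det =
      (anisoDilationCLM w R).det * (anisoDilationCLM w R⁻¹).det := LinearMap.det_comp _ _
  simp [h3, h] at h2

end Dilation

namespace HomogeneousCarnotGroup

variable {n : ℕ} (G : HomogeneousCarnotGroup n)

/-! ### The group law -/

lemma mul_inv (x : Fin n → ℝ) : G.mul x (G.inv x) = 0 := by
  have h : G.mul (G.inv (G.inv x)) (G.mul (G.inv x) (G.mul x (G.inv x))) =
      G.mul (G.inv (G.inv x)) (G.inv x) := by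
    rw [← G.mul_assoc (G.inv x), G.inv_mul, G.zero_mul]
  rwa [← G.mul_assoc, G.inv_mul, G.zero_mul] at h

lemma inv_mul_cancel_left (x y : Fin n → ℝ) : G.mul (G.inv x) (G.mul x y) = y := by
  rw [← G.mul_assoc, G.inv_mul, G.zero_mul]

lemma mul_inv_cancel_left (x y : Fin n → ℝ) : G.mul x (G.mul (G.inv x) y) = y := by
  rw [← G.mul_assoc, G.mul_inv, G.zero_mul]

lemma mul_inv_cancel_right (x y : Fin n → ℝ) : G.mul (G.mul x y) (G.inv y) = x := by
  rw [G.mul_assoc, G.mul_inv, G.mul_zero]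

lemma inv_mul_cancel_right (x y : Fin n → ℝ) : G.mul (G.mul x (G.inv y)) y = x := by
  rw [G.mul_assoc, G.inv_mul, G.mul_zero]

lemma eq_inv_of_mul_eq_zero {x y : Fin n → ℝ} (h : G.mul x y = 0) : x = G.inv y := by
  rw [← G.mul_inv_cancel_right x y, h, G.zero_mul]

lemma mul_left_injective (y : Fin n → ℝ) : Function.Injective fun x => G.mul x y :=
  fun a b h => by
    rw [← G.mul_inv_cancel_right a y, ← G.mul_inv_cancel_right b y]; simp only at h; rw [h]

lemma inv_inv (x : Fin n → ℝ) : G.inv (G.inv x) = x :=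
  (G.eq_inv_of_mul_eq_zero (G.mul_inv x)).symm

lemma inv_mul_rev (x y : Fin n → ℝ) : G.inv (G.mul x y) = G.mul (G.inv y) (G.inv x) := by
  symm; apply G.eq_inv_of_mul_eq_zero
  rw [G.mul_assoc, G.inv_mul_cancel_left, G.inv_mul]

lemma inv_zero : G.inv 0 = 0 := by
  rw [← G.mul_zero (G.inv 0), G.inv_mul]

lemma contDiff_mul_comp {E : Type*} [NormedAddCommGroup E] [NormedSpace ℝ E]
    {g h : E → (Fin n → ℝ)} (hg : ContDiff ℝ (⊤ : ℕ∞) g) (hh : ContDiff ℝ (⊤ : ℕ∞) h) :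
    ContDiff ℝ (⊤ : ℕ∞) fun x => G.mul (g x) (h x) :=
  G.contDiff_mul.comp (hg.prodMk hh)

@[fun_prop]
lemma continuous_mul {E : Type*} [TopologicalSpace E]
    {g h : E → (Fin n → ℝ)} (hg : Continuous g) (hh : Continuous h) :
    Continuous fun x => G.mul (g x) (h x) :=
  G.contDiff_mul.continuous.comp (hg.prodMk hh)

@[fun_prop]
lemma continuous_inv {E : Type*} [TopologicalSpace E] {g : E → (Fin n → ℝ)} (hg : Continuous g) :
    Continuous fun x => G.inv (g x) :=
  G.contDiff_inv.continuous.comp hg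

lemma differentiable_mul_left (x : Fin n → ℝ) : Differentiable ℝ (G.mul x) :=
  (G.contDiff_mul_comp contDiff_const contDiff_id).differentiable (by simp)

lemma differentiable_mul_right (z : Fin n → ℝ) : Differentiable ℝ fun x => G.mul x z :=
  (G.contDiff_mul_comp contDiff_id contDiff_const).differentiable (by simp)

/-! ### Invariance of the Lebesgue measure under right translations -/

/-- Dilations commute with the group law, so the Jacobian of a right translation is invariant
under `δ_R`; letting `R → 0` it equals its value at the unit. -/
lemma det_fderiv_mul_right (x z : Fin n → ℝ) : (fderiv ℝ (fun y => G.mul y z) x).det = 1 := by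
  set J : (Fin n → ℝ) × (Fin n → ℝ) → ℝ := fun p => (fderiv ℝ (fun y => G.mul y p.2) p.1).det
    with hJ
  have hcont : Continuous J := by
    have h1 : ContDiff ℝ (⊤ : ℕ∞)
        (Function.uncurry fun (p : (Fin n → ℝ) × (Fin n → ℝ)) (y : Fin n → ℝ) => G.mul y p.2) :=
      G.contDiff_mul_comp (contDiff_snd) (contDiff_snd.comp contDiff_fst)
    have h2 : Continuous fun p : (Fin n → ℝ) × (Fin n → ℝ) =>
        fderiv ℝ (fun y => G.mul y p.2) p.1 :=
      (ContDiff.fderiv (n := (⊤ : ℕ∞)) (m := (⊤ : ℕ∞)) h1 contDiff_fst (by simp)).continuous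
    exact ContinuousLinearMap.continuous_det.comp h2
  have hinv : ∀ R : ℝ, 0 < R →
      J (anisoDilation G.weight R x, anisoDilation G.weight R z) = J (x, z) := by
    intro R hR
    set δ := anisoDilationCLM G.weight R
    have h1 : (fun y => G.mul y (anisoDilation G.weight R z)) ∘ δ = δ ∘ fun y => G.mul y z := by
      ext1 y; simp [δ, G.dilation_mul R hR]
    have h2 : fderiv ℝ ((fun y => G.mul y (anisoDilation G.weight R z)) ∘ δ) x =
        (fderiv ℝ (fun y => G.mul y (anisoDilation G.weight R z))
          (anisoDilation G.weight R x)).comp δ := by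
      rw [fderiv_comp x (G.differentiable_mul_right _ _) δ.differentiableAt]; simp [δ]
    have h3 : fderiv ℝ (δ ∘ fun y => G.mul y z) x = δ.comp (fderiv ℝ (fun y => G.mul y z) x) := by
      rw [fderiv_comp x δ.differentiableAt (G.differentiable_mul_right _ _)]; simp
    have h4 := congrArg ContinuousLinearMap.det
      (h2.symm.trans ((congrArg (fderiv ℝ · x) h1).trans h3))
    have h5 : ∀ A B : (Fin n → ℝ) →L[ℝ] (Fin n → ℝ), (A.comp B).det = A.det * B.det :=
      fun A B => LinearMap.det_comp _ _
    rw [h5, h5, mul_comm] at h4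
    exact mul_left_cancel₀ (det_anisoDilationCLM_ne_zero G.weight hR.ne') h4
  have hlim : Tendsto (fun R : ℝ => J (anisoDilation G.weight R x, anisoDilation G.weight R z))
      (𝓝[>] 0) (𝓝 (J (0, 0))) := by
    have : Continuous fun R : ℝ => J (anisoDilation G.weight R x, anisoDilation G.weight R z) := by
      exact hcont.comp (((continuous_anisoDilation G.weight).comp
        (continuous_id.prodMk continuous_const)).prodMk
        ((continuous_anisoDilation G.weight).comp (continuous_id.prodMk continuous_const)))
    have := (this.tendsto 0).mono_left (nhdsWithin_le_nhds (s := Ioi 0))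
    rwa [anisoDilation_zero_left _ G.weight_pos, anisoDilation_zero_left _ G.weight_pos] at this
  have hlim' : Tendsto (fun R : ℝ => J (anisoDilation G.weight R x, anisoDilation G.weight R z))
      (𝓝[>] 0) (𝓝 (J (x, z))) :=
    tendsto_const_nhds.congr' (by
      filter_upwards [self_mem_nhdsWithin] with R hR using (hinv R hR).symm)
  have h0 : J (0, 0) = 1 := by
    simp only [hJ]
    have : (fun y => G.mul y 0) = id := by ext1 y; simp [G.mul_zero]
    rw [this, fderiv_id]; exact LinearMap.det_id
  exact (tendsto_nhds_unique hlim' hlim).trans h0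

lemma measurePreserving_mul_right (z : Fin n → ℝ) :
    MeasurePreserving (fun x => G.mul x z) volume volume := by
  refine ⟨(G.differentiable_mul_right z).continuous.measurable, ?_⟩
  ext s hs
  rw [Measure.map_apply (G.differentiable_mul_right z).continuous.measurable hs]
  have himg : (fun x => G.mul x z) ⁻¹' s = (fun x => G.mul x (G.inv z)) '' s := by
    ext y; constructor
    · intro hy; exact ⟨G.mul y z, hy, G.mul_inv_cancel_right y z⟩
    · rintro ⟨x, hx, rfl⟩; simpa [G.inv_mul_cancel_right] using hx
  rw [himg, ← lintegral_abs_det_fderiv_eq_addHaar_image volume hs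
    (fun x _ => ((G.differentiable_mul_right (G.inv z)) x).hasFDerivAt.hasFDerivWithinAt)
    (G.mul_left_injective _).injOn]
  simp [G.det_fderiv_mul_right]

/-- Change of variables `x ↦ x ∘ z`. -/
lemma integral_mul_right (g : (Fin n → ℝ) → ℝ) (z : Fin n → ℝ) :
    ∫ x, g (G.mul x z) = ∫ x, g x := by
  have he : MeasurableEmbedding fun x => G.mul x z :=
    (G.differentiable_mul_right z).continuous.measurableEmbedding (G.mul_left_injective z)
  exact (G.measurePreserving_mul_right z).integral_comp he g

/-! ### One-parameter subgroups -/

section OneParameter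

open scoped Manifold

lemma contDiff_leftInvField (j : Fin n) : ContDiff ℝ (⊤ : ℕ∞) (leftInvField G.mul j) := by
  have h1 : ContDiff ℝ (⊤ : ℕ∞)
      (Function.uncurry fun (x : Fin n → ℝ) (y : Fin n → ℝ) => G.mul x y) :=
    G.contDiff_mul
  exact (ContDiff.fderiv (n := (⊤ : ℕ∞)) (m := (⊤ : ℕ∞)) h1 (contDiff_const (c := 0))
    (by simp)).clm_apply contDiff_const

/-- Left translations preserve `X_j`. -/
lemma fderiv_mul_leftInvField (j : Fin n) (x y : Fin n → ℝ) :
    fderiv ℝ (G.mul x) y (leftInvField G.mul j y) = leftInvField G.mul j (G.mul x y) := by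
  have h : (fun z => G.mul (G.mul x y) z) = G.mul x ∘ G.mul y := by
    ext1 z; simp [G.mul_assoc]
  unfold leftInvField
  rw [h, fderiv_comp 0 (G.differentiable_mul_left x _) (G.differentiable_mul_left y _)]
  simp [G.mul_zero]

/-- `X_j` is homogeneous of degree one with respect to the dilations. -/
lemma anisoDilation_leftInvField {j : Fin n} (hj : G.weight j = 1) {R : ℝ} (hR : 0 < R)
    (x : Fin n → ℝ) :
    anisoDilation G.weight R (leftInvField G.mul j x) =
      R • leftInvField G.mul j (anisoDilation G.weight R x) := by
  set δ := anisoDilationCLM G.weight R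
  have h1 : G.mul (anisoDilation G.weight R x) ∘ δ = δ ∘ G.mul x := by
    ext1 y; simp [δ, G.dilation_mul R hR]
  have h2 : fderiv ℝ (G.mul (anisoDilation G.weight R x) ∘ δ) 0 =
      (fderiv ℝ (G.mul (anisoDilation G.weight R x)) 0).comp δ := by
    rw [fderiv_comp 0 (G.differentiable_mul_left _ _) δ.differentiableAt]
    simp [δ, anisoDilation_zero_right]
  have h3 : fderiv ℝ (δ ∘ G.mul x) 0 = δ.comp (fderiv ℝ (G.mul x) 0) := by
    rw [fderiv_comp 0 δ.differentiableAt (G.differentiable_mul_left _ _)]; simp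
  have h4 := h2.symm.trans ((congrArg (fderiv ℝ · 0) h1).trans h3)
  have h5 := DFunLike.congr_fun h4 (Pi.single j 1)
  simp only [ContinuousLinearMap.comp_apply, δ, anisoDilationCLM_apply,
    anisoDilation_single G.weight hj, map_smul] at h5
  exact h5.symm

/-- `X_j` has a global integral curve through `0`: left translations give local integral curves
of a uniform length through every point. -/
lemma exists_integralCurve (j : Fin n) :
    ∃ γ : ℝ → (Fin n → ℝ), γ 0 = 0 ∧ ∀ t, HasDerivAt γ (leftInvField G.mul j (γ t)) t := by
  let v : (x : Fin n → ℝ) → TangentSpace 𝓘(ℝ, Fin n → ℝ) x := leftInvField G.mul j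
  have hv : ContMDiff 𝓘(ℝ, Fin n → ℝ) 𝓘(ℝ, Fin n → ℝ).tangent 1
      (fun x => (⟨x, v x⟩ : TangentBundle 𝓘(ℝ, Fin n → ℝ) (Fin n → ℝ))) :=
    contMDiff_vectorSpace_iff_contDiff.2 ((G.contDiff_leftInvField j).of_le (by simp))
  obtain ⟨α, hα0, ε, hε, hα⟩ := (((G.contDiff_leftInvField j).of_le
    (by simp : (1 : WithTop ℕ∞) ≤ _)).contDiffAt (x := 0)
    ).exists_forall_mem_closedBall_exists_eq_forall_mem_Ioo_hasDerivAt₀ 0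
  rw [zero_sub, zero_add] at hα
  obtain ⟨γ, h0, hγ⟩ := exists_isMIntegralCurve_of_isMIntegralCurveOn hv hε (fun x => by
    refine ⟨fun t => G.mul x (α t), by simp [hα0, G.mul_zero], fun t ht => ?_⟩
    have h1 : HasDerivAt (fun t => G.mul x (α t)) (leftInvField G.mul j (G.mul x (α t))) t := by
      rw [← G.fderiv_mul_leftInvField]
      exact ((G.differentiable_mul_left x (α t)).hasFDerivAt).comp_hasDerivAt t (hα t ht)
    exact h1.hasFDerivAt.hasMFDerivAt.hasMFDerivWithinAt) 0
  refine ⟨γ, h0, fun t => ?_⟩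
  have h1 : HasFDerivAt γ
      ((1 : ℝ →L[ℝ] ℝ).smulRight (leftInvField G.mul j (γ t))) t :=
    hasMFDerivAt_iff_hasFDerivAt.1 (hγ t)
  simpa using h1.hasDerivAt

lemma integralCurve_unique (j : Fin n) {α β : ℝ → (Fin n → ℝ)}
    (hα : ∀ t, HasDerivAt α (leftInvField G.mul j (α t)) t)
    (hβ : ∀ t, HasDerivAt β (leftInvField G.mul j (β t)) t) (h : α 0 = β 0) : α = β := by
  let v : (x : Fin n → ℝ) → TangentSpace 𝓘(ℝ, Fin n → ℝ) x := leftInvField G.mul j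
  have hv : ContMDiff 𝓘(ℝ, Fin n → ℝ) 𝓘(ℝ, Fin n → ℝ).tangent 1
      (fun x => (⟨x, v x⟩ : TangentBundle 𝓘(ℝ, Fin n → ℝ) (Fin n → ℝ))) :=
    contMDiff_vectorSpace_iff_contDiff.2 ((G.contDiff_leftInvField j).of_le (by simp))
  have hα' : IsMIntegralCurve α v := fun t => (hα t).hasFDerivAt.hasMFDerivAt
  have hβ' : IsMIntegralCurve β v := fun t => (hβ t).hasFDerivAt.hasMFDerivAt
  exact isMIntegralCurve_Ioo_eq_of_contMDiff_boundaryless (t₀ := 0) hv hα' hβ' h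

/-- The one-parameter subgroup `t ↦ exp (t X_j)`, the integral curve of `X_j` through the unit. -/
noncomputable def expCurve (j : Fin n) : ℝ → (Fin n → ℝ) := (G.exists_integralCurve j).choose

lemma expCurve_zero (j : Fin n) : G.expCurve j 0 = 0 := (G.exists_integralCurve j).choose_spec.1

lemma hasDerivAt_expCurve (j : Fin n) (t : ℝ) :
    HasDerivAt (G.expCurve j) (leftInvField G.mul j (G.expCurve j t)) t :=
  (G.exists_integralCurve j).choose_spec.2 t

lemma continuous_expCurve (j : Fin n) : Continuous (G.expCurve j) :=
  continuous_iff_continuousAt.2 fun t => (G.hasDerivAt_expCurve j t).continuousAt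

/-- Left translates of the one-parameter subgroup are integral curves of `X_j`. -/
lemma hasDerivAt_mul_expCurve (j : Fin n) (x : Fin n → ℝ) (t : ℝ) :
    HasDerivAt (fun t => G.mul x (G.expCurve j t))
      (leftInvField G.mul j (G.mul x (G.expCurve j t))) t := by
  rw [← G.fderiv_mul_leftInvField]
  exact ((G.differentiable_mul_left x _).hasFDerivAt).comp_hasDerivAt t (G.hasDerivAt_expCurve j t)

lemma expCurve_add (j : Fin n) (s t : ℝ) :
    G.expCurve j (s + t) = G.mul (G.expCurve j s) (G.expCurve j t) := by
  have h := G.integralCurve_unique j (α := fun t => G.expCurve j (s + t))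
    (β := fun t => G.mul (G.expCurve j s) (G.expCurve j t))
    (fun t => by
      simpa using (G.hasDerivAt_expCurve j (s + t)).comp_const_add s t)
    (fun t => G.hasDerivAt_mul_expCurve j _ t) (by simp [expCurve_zero, G.mul_zero])
  exact congrFun h t

lemma expCurve_neg (j : Fin n) (t : ℝ) : G.expCurve j (-t) = G.inv (G.expCurve j t) := by
  apply G.eq_inv_of_mul_eq_zero
  rw [← expCurve_add]; simp [expCurve_zero]

lemma anisoDilation_expCurve {j : Fin n} (hj : G.weight j = 1) {R : ℝ} (hR : 0 < R) (t : ℝ) :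
    anisoDilation G.weight R (G.expCurve j t) = G.expCurve j (R * t) := by
  have h := G.integralCurve_unique j
    (α := fun t => anisoDilation G.weight R (G.expCurve j (R⁻¹ * t))) (β := G.expCurve j)
    (fun t => by
      have h1 := ((anisoDilationCLM G.weight R).hasFDerivAt).comp_hasDerivAt t
        ((G.hasDerivAt_expCurve j (R⁻¹ * t)).scomp t ((hasDerivAt_id t).const_mul R⁻¹))
      have h2 : leftInvField G.mul j (anisoDilation G.weight R (G.expCurve j (R⁻¹ * t))) =
          anisoDilationCLM G.weight R
            ((R⁻¹ * 1) • leftInvField G.mul j (G.expCurve j (R⁻¹ * t))) := by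
        rw [map_smul, anisoDilationCLM_apply, G.anisoDilation_leftInvField hj hR, smul_smul]
        simp [hR.ne']
      rw [h2]
      refine h1.congr_of_eventuallyEq (Eventually.of_forall fun s => ?_)
      simp)
    (G.hasDerivAt_expCurve j) (by simp [expCurve_zero, anisoDilation_zero_right])
  have := congrFun h (R * t)
  simpa [← mul_assoc, hR.ne'] using this

end OneParameter

/-! ### Homogeneous norms -/

namespace IsHomogeneousNorm

variable {G} {r : (Fin n → ℝ) → ℝ}

lemma map_zero (hr : G.IsHomogeneousNorm r) : r 0 = 0 :=
  le_antisymm (not_lt.1 fun h => (hr.pos_iff 0).1 h rfl) (hr.nonneg 0)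

lemma symm_dist (hr : G.IsHomogeneousNorm r) (x y : Fin n → ℝ) :
    r (G.mul (G.inv x) y) = r (G.mul (G.inv y) x) := by
  rw [← hr.symm, G.inv_mul_rev, G.inv_inv]

lemma map_expCurve (hr : G.IsHomogeneousNorm r) {j : Fin n} (hj : G.weight j = 1) (t : ℝ) :
    r (G.expCurve j t) = |t| * r (G.expCurve j 1) := by
  have hpos : ∀ s : ℝ, 0 < s → r (G.expCurve j s) = s * r (G.expCurve j 1) := fun s hs => by
    rw [← hr.dilation s hs, G.anisoDilation_expCurve hj hs, mul_one]
  rcases lt_trichotomy t 0 with h | rfl | h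
  · rw [← neg_neg t, G.expCurve_neg, hr.symm, hpos _ (neg_pos.2 h), abs_neg,
      abs_of_pos (neg_pos.2 h)]
  · simp [G.expCurve_zero, hr.map_zero]
  · rw [hpos t h, abs_of_pos h]

/-- A homogeneous norm is proper at the origin: on the unit sphere it has a positive minimum, and
the dilations carry every other point to that sphere. -/
lemma exists_lt_imp_norm_lt (hr : G.IsHomogeneousNorm r) {ρ : ℝ} (hρ : 0 < ρ) :
    ∃ m, 0 < m ∧ ∀ z, r z < m → ‖z‖ < ρ := by
  have hcompact : IsCompact (Metric.sphere (0 : Fin n → ℝ) ρ) := isCompact_sphere _ _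
  obtain ⟨m, hm, hmin⟩ : ∃ m, 0 < m ∧ ∀ z ∈ Metric.sphere (0 : Fin n → ℝ) ρ, m ≤ r z := by
    rcases (Metric.sphere (0 : Fin n → ℝ) ρ).eq_empty_or_nonempty with h | h
    · exact ⟨1, one_pos, by simp [h]⟩
    · obtain ⟨z, hz, hzm⟩ := hcompact.exists_isMinOn h hr.continuous.continuousOn
      refine ⟨r z, (hr.pos_iff z).2 ?_, hzm⟩
      rintro rfl
      simp at hz; exact hρ.ne hz
  refine ⟨m, hm, fun z hz => ?_⟩
  by_contra! hzρ
  have hc : ContinuousOn (fun R : ℝ => ‖anisoDilation G.weight R z‖) (Icc 0 1) :=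
    ((continuous_anisoDilation G.weight).comp
      (continuous_id.prodMk continuous_const)).norm.continuousOn
  obtain ⟨R, hR, hRz⟩ := intermediate_value_Icc zero_le_one hc
    (show ρ ∈ Icc _ _ by
      simp only [anisoDilation_zero_left _ G.weight_pos, anisoDilation_one, norm_zero]
      exact ⟨hρ.le, hzρ⟩)
  have hR0 : 0 < R := by
    rcases hR.1.eq_or_lt with h | h
    · subst h; simp [anisoDilation_zero_left _ G.weight_pos] at hRz; exact absurd hRz hρ.ne
    · exact h
  have h1 := hmin _ (by simpa using hRz : anisoDilation G.weight R z ∈ _)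
  rw [hr.dilation R hR0] at h1
  nlinarith [hr.nonneg z, hR.2]

/-- Near the origin the Euclidean norm is controlled by the homogeneous norm, all weights being at
least one. -/
lemma exists_norm_le (hr : G.IsHomogeneousNorm r) :
    ∃ A, 0 < A ∧ ∀ z, r z ≤ 1 → ‖z‖ ≤ A * r z := by
  obtain ⟨m, hm, h⟩ := hr.exists_lt_imp_norm_lt one_pos
  -- `δ_R z` has homogeneous norm `m / 2` for `R = m / (2 r z)`, so that `|z i| ≤ R ^ (-weight i)`
  refine ⟨max 1 (2 / m) ^ (∑ i, G.weight i), by positivity, fun z hz => ?_⟩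
  rcases (hr.nonneg z).eq_or_lt with h0 | h0
  · have : z = 0 := by by_contra hne; exact ((hr.pos_iff z).2 hne).ne h0
    subst this; simp [hr.map_zero]
  set R := m / 2 / r z with hR
  have hRpos : 0 < R := by positivity
  have h1 : ‖anisoDilation G.weight R z‖ < 1 := by
    apply h; rw [hr.dilation R hRpos, hR, div_mul_cancel₀ _ h0.ne']; linarith
  refine (pi_norm_le_iff_of_nonneg (by positivity)).2 fun i => ?_
  have h2 : ‖R ^ G.weight i * z i‖ ≤ 1 :=
    (norm_le_pi_norm (anisoDilation G.weight R z) i).trans h1.le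
  rw [norm_mul, norm_pow, Real.norm_of_nonneg hRpos.le] at h2
  have h3 : ‖z i‖ ≤ (R ^ G.weight i)⁻¹ := by
    rw [← one_div, le_div_iff₀ (by positivity)]; linarith
  have h4 : (R ^ G.weight i)⁻¹ = (2 / m) ^ G.weight i * r z ^ G.weight i := by
    rw [← mul_pow, ← inv_pow, hR]; congr 1; field_simp
  rw [h4] at h3
  refine h3.trans (mul_le_mul ?_ ?_ (by positivity) (by positivity))
  · calc (2 / m) ^ G.weight i ≤ max 1 (2 / m) ^ G.weight i :=
        pow_le_pow_left₀ (by positivity) (le_max_right _ _) _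
      _ ≤ _ := pow_le_pow_right₀ (le_max_left _ _)
        (Finset.single_le_sum (f := G.weight) (fun _ _ => Nat.zero_le _) (Finset.mem_univ i))
  · calc r z ^ G.weight i ≤ r z ^ 1 := pow_le_pow_of_le_one h0.le hz (G.weight_pos i)
      _ = r z := pow_one _

end IsHomogeneousNorm

end HomogeneousCarnotGroup

namespace HomogeneousCarnotGroup

variable {n : ℕ} {G : HomogeneousCarnotGroup n} {r : (Fin n → ℝ) → ℝ}

/-! ### Lipschitz functions for the homogeneous norm -/

lemma IsLipOn.abs_sub_le (hr : G.IsHomogeneousNorm r) {u : (Fin n → ℝ) → ℝ} {U : Set (Fin n → ℝ)}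
    (hu : G.IsLipOn r u U) :
    ∃ C, 0 < C ∧ ∀ x ∈ U, ∀ y ∈ U, |u x - u y| ≤ C * r (G.mul (G.inv x) y) := by
  obtain ⟨C, hC, h⟩ := hu
  refine ⟨C, hC, fun x hx y hy => abs_sub_le_iff.2 ⟨h x hx y hy, ?_⟩⟩
  rw [hr.symm_dist]; exact h y hy x hx

lemma tendsto_norm_inv_mul (hr : G.IsHomogeneousNorm r) (x : Fin n → ℝ) :
    Tendsto (fun y => r (G.mul (G.inv x) y)) (𝓝 x) (𝓝 0) := by
  have h : Continuous fun y => r (G.mul (G.inv x) y) :=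
    hr.continuous.comp (G.continuous_mul continuous_const continuous_id)
  simpa [G.inv_mul, hr.map_zero] using h.tendsto x

lemma IsLipLoc.continuous (hr : G.IsHomogeneousNorm r) {u : (Fin n → ℝ) → ℝ}
    (hu : G.IsLipLoc r u) : Continuous u := by
  refine continuous_iff_continuousAt.2 fun x => ?_
  obtain ⟨U, hU, h⟩ := hu x
  obtain ⟨C, -, h⟩ := h.abs_sub_le hr
  rw [ContinuousAt, tendsto_iff_dist_tendsto_zero]
  have h0 : Tendsto (fun y => C * r (G.mul (G.inv x) y)) (𝓝 x) (𝓝 0) := by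
    simpa using (tendsto_norm_inv_mul hr x).const_mul C
  refine squeeze_zero' (Eventually.of_forall fun _ => dist_nonneg) ?_ h0
  filter_upwards [hU] with y hy
  rw [dist_comm, Real.dist_eq]
  exact h x (mem_of_mem_nhds hU) y hy

/-- On a compact set the local Lipschitz bounds hold at one scale with one constant. -/
lemma IsLipLoc.exists_uniform (hr : G.IsHomogeneousNorm r) {u : (Fin n → ℝ) → ℝ}
    (hu : G.IsLipLoc r u) {K : Set (Fin n → ℝ)} (hK : IsCompact K) :
    ∃ ε, 0 < ε ∧ ∃ C, 0 < C ∧ ∀ x ∈ K, ∀ y, r (G.mul (G.inv x) y) < ε →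
      |u x - u y| ≤ C * r (G.mul (G.inv x) y) := by
  refine hK.induction_on ⟨1, one_pos, 1, one_pos, by simp⟩ ?_ ?_ ?_
  · rintro s t hst ⟨ε, hε, C, hC, h⟩
    exact ⟨ε, hε, C, hC, fun x hx => h x (hst hx)⟩
  · rintro s t ⟨ε, hε, C, hC, h⟩ ⟨ε', hε', C', hC', h'⟩
    refine ⟨min ε ε', lt_min hε hε', max C C', lt_max_of_lt_left hC, ?_⟩
    rintro x (hx | hx) y hy
    · exact (h x hx y (hy.trans_le (min_le_left _ _))).trans
        (mul_le_mul_of_nonneg_right (le_max_left _ _) (hr.nonneg _))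
    · exact (h' x hx y (hy.trans_le (min_le_right _ _))).trans
        (mul_le_mul_of_nonneg_right (le_max_right _ _) (hr.nonneg _))
  · intro x _
    obtain ⟨U, hU, h⟩ := hu x
    obtain ⟨C, hC, h⟩ := h.abs_sub_le hr
    have hc : Continuous fun p : (Fin n → ℝ) × (Fin n → ℝ) => G.mul p.1 p.2 :=
      G.contDiff_mul.continuous
    have hx0 : (fun p : (Fin n → ℝ) × (Fin n → ℝ) => G.mul p.1 p.2) ⁻¹' U ∈ 𝓝 (x, 0) :=
      hc.continuousAt.preimage_mem_nhds (by simpa [G.mul_zero] using hU)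
    rw [nhds_prod_eq] at hx0
    obtain ⟨V, hV, W, hW, hVW⟩ := mem_prod_iff.1 hx0
    obtain ⟨ρ, hρ, hρW⟩ := Metric.mem_nhds_iff.1 hW
    obtain ⟨m, hm, hmz⟩ := hr.exists_lt_imp_norm_lt hρ
    refine ⟨V ∩ U, mem_nhdsWithin_of_mem_nhds (inter_mem hV hU), m, hm, C, hC, ?_⟩
    rintro y ⟨hyV, hyU⟩ z hz
    have hz' : G.mul (G.inv y) z ∈ W := hρW (by simpa using hmz _ hz)
    have : G.mul y (G.mul (G.inv y) z) ∈ U := hVW (mk_mem_prod hyV hz')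
    rw [G.mul_inv_cancel_left] at this
    exact h y hyU z this

lemma IsLipLoc.isLipC (hr : G.IsHomogeneousNorm r) {u : (Fin n → ℝ) → ℝ}
    (hu : G.IsLipLoc r u) (hc : HasCompactSupport u) : G.IsLipC r u := by
  obtain ⟨ε, hε, C, hC, h⟩ := hu.exists_uniform hr hc
  obtain ⟨M, hM⟩ := hc.exists_bound_of_continuous (hu.continuous hr)
  have hM0 : 0 ≤ M := (norm_nonneg _).trans (hM 0)
  refine ⟨⟨C + 2 * M / ε, by positivity, fun x _ y _ => ?_⟩, hc⟩
  have hnn := hr.nonneg (G.mul (G.inv x) y)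
  by_cases hd : r (G.mul (G.inv x) y) < ε
  · have hle : C * r (G.mul (G.inv x) y) ≤ (C + 2 * M / ε) * r (G.mul (G.inv x) y) := by
      gcongr; have : 0 ≤ 2 * M / ε := by positivity
      linarith
    refine le_trans ?_ hle
    by_cases hx : x ∈ tsupport u
    · exact (le_abs_self _).trans (h x hx y hd)
    by_cases hy : y ∈ tsupport u
    · rw [hr.symm_dist] at hd ⊢
      rw [← neg_sub]
      exact (neg_le_abs _).trans (h y hy x hd)
    · rw [image_eq_zero_of_notMem_tsupport hx, image_eq_zero_of_notMem_tsupport hy]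
      simp; positivity
  · push Not at hd
    have h1 : u x - u y ≤ 2 * M := by
      have := hM x; have := hM y
      rw [Real.norm_eq_abs, abs_le] at *
      linarith
    calc u x - u y ≤ 2 * M / ε * ε := by rwa [div_mul_cancel₀ _ hε.ne']
      _ ≤ 2 * M / ε * r (G.mul (G.inv x) y) := by gcongr
      _ ≤ _ := by gcongr; linarith

lemma IsLipLoc.comp (hr : G.IsHomogeneousNorm r) {u : (Fin n → ℝ) → ℝ} (hu : G.IsLipLoc r u)
    {h : ℝ → ℝ} (hh : LocallyLipschitz h) : G.IsLipLoc r (fun x => h (u x)) := by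
  intro x
  obtain ⟨U, hU, hx⟩ := hu x
  obtain ⟨C, hC, hx⟩ := hx.abs_sub_le hr
  obtain ⟨K, t, ht, hK⟩ := hh (u x)
  refine ⟨U ∩ u ⁻¹' t, inter_mem hU ((hu.continuous hr).continuousAt.preimage_mem_nhds ht),
    (K + 1) * C, by positivity, ?_⟩
  rintro y ⟨hyU, hyt⟩ z ⟨hzU, hzt⟩
  have h1 := hK.dist_le_mul _ hyt _ hzt
  rw [Real.dist_eq, Real.dist_eq] at h1
  calc h (u y) - h (u z) ≤ K * |u y - u z| := (le_abs_self _).trans h1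
    _ ≤ (K + 1) * (C * r (G.mul (G.inv y) z)) := by
        gcongr
        · simp
        · exact hx y hyU z hzU
    _ = _ := by ring

lemma IsLipLoc.neg (hr : G.IsHomogeneousNorm r) {u : (Fin n → ℝ) → ℝ} (hu : G.IsLipLoc r u) :
    G.IsLipLoc r (fun x => -u x) :=
  hu.comp hr (h := fun s => -s) LipschitzWith.id.neg.locallyLipschitz

lemma IsLipLoc.mul (hr : G.IsHomogeneousNorm r) {u v : (Fin n → ℝ) → ℝ} (hu : G.IsLipLoc r u)
    (hv : G.IsLipLoc r v) : G.IsLipLoc r (fun x => u x * v x) := by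
  intro x
  obtain ⟨U, hU, hx⟩ := hu x
  obtain ⟨C, hC, hx⟩ := hx.abs_sub_le hr
  obtain ⟨V, hV, hy⟩ := hv x
  obtain ⟨D, hD, hy⟩ := hy.abs_sub_le hr
  have h1 : ∀ᶠ y in 𝓝 x, |u y| < |u x| + 1 :=
    (hu.continuous hr).abs.continuousAt.eventually_lt_const (by linarith)
  have h2 : ∀ᶠ y in 𝓝 x, |v y| < |v x| + 1 :=
    (hv.continuous hr).abs.continuousAt.eventually_lt_const (by linarith)
  refine ⟨_, inter_mem (inter_mem hU hV) (inter_mem h1 h2),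
    (|u x| + 1) * D + (|v x| + 1) * C, by positivity, ?_⟩
  rintro y ⟨⟨hyU, hyV⟩, hy1, hy2⟩ z ⟨⟨hzU, hzV⟩, hz1, hz2⟩
  have e : u y * v y - u z * v z = u y * (v y - v z) + v z * (u y - u z) := by ring
  rw [e]
  have hnn := hr.nonneg (G.mul (G.inv y) z)
  calc _ ≤ |u y| * |v y - v z| + |v z| * |u y - u z| := by
        rw [← abs_mul, ← abs_mul]; exact add_le_add (le_abs_self _) (le_abs_self _)
    _ ≤ (|u x| + 1) * (D * r (G.mul (G.inv y) z)) + (|v x| + 1) * (C * r (G.mul (G.inv y) z)) := by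
        have := hx y hyU z hzU
        have := hy y hyV z hzV
        have := (show |u y| < |u x| + 1 from hy1).le
        have := (show |v z| < |v x| + 1 from hz2).le
        gcongr
    _ = _ := by ring

/-- Smooth functions are locally Lipschitz for the homogeneous norm, which dominates the Euclidean
norm near the origin. -/
lemma isLipLoc_of_contDiff (hr : G.IsHomogeneousNorm r) {ψ : (Fin n → ℝ) → ℝ}
    (hψ : ContDiff ℝ (⊤ : ℕ∞) ψ) : G.IsLipLoc r ψ := by
  intro x
  obtain ⟨A, hA, hAz⟩ := hr.exists_norm_le
  have hF : ContDiff ℝ 1 fun p : (Fin n → ℝ) × (Fin n → ℝ) => ψ (G.mul p.1 p.2) :=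
    (hψ.comp G.contDiff_mul).of_le (by simp)
  obtain ⟨K, t, ht, hK⟩ := hF.locallyLipschitz (x, 0)
  rw [nhds_prod_eq] at ht
  obtain ⟨V, hV, W, hW, hVW⟩ := mem_prod_iff.1 ht
  obtain ⟨ρ, hρ, hρW⟩ := Metric.mem_nhds_iff.1 hW
  obtain ⟨m, hm, hmz⟩ := hr.exists_lt_imp_norm_lt hρ
  have hd : ∀ᶠ p : (Fin n → ℝ) × (Fin n → ℝ) in 𝓝 (x, x),
      r (G.mul (G.inv p.1) p.2) < min m 1 := by
    have hc : Continuous fun p : (Fin n → ℝ) × (Fin n → ℝ) => r (G.mul (G.inv p.1) p.2) :=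
      hr.continuous.comp (G.continuous_mul (G.continuous_inv continuous_fst) continuous_snd)
    exact hc.continuousAt.eventually_lt_const
      (by simp [G.inv_mul, hr.map_zero, hm])
  rw [nhds_prod_eq] at hd
  obtain ⟨V₁, hV₁, V₂, hV₂, hVV⟩ := mem_prod_iff.1 hd
  refine ⟨V ∩ (V₁ ∩ V₂), inter_mem hV (inter_mem hV₁ hV₂), (K + 1) * A, by positivity, ?_⟩
  rintro y ⟨hyV, hy1, -⟩ z ⟨-, -, hz2⟩
  have hyz : r (G.mul (G.inv y) z) < min m 1 := hVV (mk_mem_prod hy1 hz2)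
  have h1 : G.mul (G.inv y) z ∈ W := hρW (by simpa using hmz _ (hyz.trans_le (min_le_left _ _)))
  have h0 : (0 : Fin n → ℝ) ∈ W := mem_of_mem_nhds hW
  have h2 := hK.dist_le_mul _ (hVW (mk_mem_prod hyV h0)) _ (hVW (mk_mem_prod hyV h1))
  simp only [G.mul_zero, G.mul_inv_cancel_left] at h2
  have h3 : dist (y, (0 : Fin n → ℝ)) (y, G.mul (G.inv y) z) = ‖G.mul (G.inv y) z‖ := by
    rw [Prod.dist_eq]; simp
  rw [h3, Real.dist_eq] at h2
  calc ψ y - ψ z ≤ K * ‖G.mul (G.inv y) z‖ := (le_abs_self _).trans h2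
    _ ≤ (K + 1) * (A * r (G.mul (G.inv y) z)) := by
        gcongr
        · simp
        · exact hAz _ (hyz.le.trans (min_le_right _ _))
    _ = _ := by ring

/-! ### Derivatives along one-parameter subgroups -/

variable (G) in
/-- The pointwise derivative of `u` at `x` along the integral curve of `X_j` through `x`
(`0` if it does not exist). -/
noncomputable def curveDeriv (j : Fin n) (u : (Fin n → ℝ) → ℝ) (x : Fin n → ℝ) : ℝ :=
  deriv (fun t => u (G.mul x (G.expCurve j t))) 0

variable (G) in
/-- `u` is differentiable at `x` along the integral curve of `X_j` through `x`. -/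
def CurveDifferentiableAt (j : Fin n) (u : (Fin n → ℝ) → ℝ) (x : Fin n → ℝ) : Prop :=
  DifferentiableAt ℝ (fun t => u (G.mul x (G.expCurve j t))) 0

lemma CurveDifferentiableAt.hasDerivAt {j : Fin n} {u : (Fin n → ℝ) → ℝ} {x : Fin n → ℝ}
    (h : G.CurveDifferentiableAt j u x) :
    HasDerivAt (fun t => u (G.mul x (G.expCurve j t))) (G.curveDeriv j u x) 0 :=
  DifferentiableAt.hasDerivAt h

lemma mul_expCurve_zero (j : Fin n) (x : Fin n → ℝ) : G.mul x (G.expCurve j 0) = x := by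
  rw [G.expCurve_zero, G.mul_zero]

lemma hasDerivAt_comp_expCurve_of_differentiable {j : Fin n} {ψ : (Fin n → ℝ) → ℝ}
    (hψ : Differentiable ℝ ψ) (x : Fin n → ℝ) :
    HasDerivAt (fun t => ψ (G.mul x (G.expCurve j t)))
      (fderiv ℝ ψ x (leftInvField G.mul j x)) 0 := by
  have h1 := G.hasDerivAt_mul_expCurve j x 0
  have h2 := ((hψ (G.mul x (G.expCurve j 0))).hasFDerivAt).comp_hasDerivAt (0 : ℝ) h1
  rwa [mul_expCurve_zero] at h2

lemma continuous_mul_expCurve (j : Fin n) :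
    Continuous fun p : (Fin n → ℝ) × ℝ => G.mul p.1 (G.expCurve j p.2) :=
  G.continuous_mul continuous_fst ((G.continuous_expCurve j).comp continuous_snd)

lemma measurable_curveDeriv (j : Fin n) {u : (Fin n → ℝ) → ℝ} (hu : Continuous u) :
    Measurable (G.curveDeriv j u) := by
  have : Continuous
      (Function.uncurry fun (x : Fin n → ℝ) (t : ℝ) => u (G.mul x (G.expCurve j t))) :=
    hu.comp (continuous_mul_expCurve j)
  exact (measurable_deriv_with_param this).comp measurable_prodMk_right

lemma measurableSet_curveDifferentiableAt (j : Fin n) {u : (Fin n → ℝ) → ℝ} (hu : Continuous u) :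
    MeasurableSet {x | G.CurveDifferentiableAt j u x} := by
  have : Continuous
      (Function.uncurry fun (x : Fin n → ℝ) (t : ℝ) => u (G.mul x (G.expCurve j t))) :=
    hu.comp (continuous_mul_expCurve j)
  exact measurable_prodMk_right (measurableSet_of_differentiableAt_with_param ℝ this)

/-- Along the flow of `X_j`, a locally Lipschitz function is Lipschitz for short times, uniformly
on compact sets. -/
lemma IsLipLoc.exists_flow_bound (hr : G.IsHomogeneousNorm r) {u : (Fin n → ℝ) → ℝ}
    (hu : G.IsLipLoc r u) {j : Fin n} (hj : G.weight j = 1) {K : Set (Fin n → ℝ)}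
    (hK : IsCompact K) :
    ∃ ε, 0 < ε ∧ ∃ C, 0 < C ∧ ∀ x ∈ K, ∀ t, |t| < ε →
      |u (G.mul x (G.expCurve j t)) - u x| ≤ C * |t| := by
  obtain ⟨ε, hε, C, hC, h⟩ := hu.exists_uniform hr hK
  set a := r (G.expCurve j 1)
  have ha : 0 ≤ a := hr.nonneg _
  refine ⟨ε / (a + 1), by positivity, C * (a + 1), by positivity, fun x hx t ht => ?_⟩
  have h1 : r (G.mul (G.inv x) (G.mul x (G.expCurve j t))) = |t| * a := by
    rw [G.inv_mul_cancel_left, hr.map_expCurve hj]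
  have h2 : |t| * a < ε := by
    rw [lt_div_iff₀ (by positivity)] at ht
    nlinarith [abs_nonneg t]
  rw [abs_sub_comm]
  refine (h x hx _ (by rwa [h1])).trans ?_
  rw [h1]; nlinarith [abs_nonneg t, mul_nonneg hC.le (abs_nonneg t)]

lemma IsLipLoc.exists_curveDeriv_bound (hr : G.IsHomogeneousNorm r) {u : (Fin n → ℝ) → ℝ}
    (hu : G.IsLipLoc r u) {j : Fin n} (hj : G.weight j = 1) {K : Set (Fin n → ℝ)}
    (hK : IsCompact K) : ∃ C, 0 < C ∧ ∀ x ∈ K, |G.curveDeriv j u x| ≤ C := by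
  obtain ⟨ε, hε, C, hC, h⟩ := hu.exists_flow_bound hr hj hK
  refine ⟨C, hC, fun x hx => ?_⟩
  rw [← Real.norm_eq_abs]
  refine norm_deriv_le_of_lip' (𝕜 := ℝ) hC.le ?_
  filter_upwards [Metric.ball_mem_nhds (0 : ℝ) hε] with t ht
  simpa [mul_expCurve_zero] using h x hx t (by simpa using ht)

/-- Rademacher's theorem along the flow of `X_j`: on each integral curve a locally Lipschitz
function is differentiable at almost every time, and the flow preserves the Lebesgue measure. -/
lemma IsLipLoc.ae_curveDifferentiableAt (hr : G.IsHomogeneousNorm r) {u : (Fin n → ℝ) → ℝ}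
    (hu : G.IsLipLoc r u) {j : Fin n} (hj : G.weight j = 1) :
    ∀ᵐ x, G.CurveDifferentiableAt j u x := by
  have hcont := hu.continuous hr
  have hline : ∀ x, ∀ᵐ t : ℝ, DifferentiableAt ℝ (fun t => u (G.mul x (G.expCurve j t))) t := by
    intro x
    rw [ae_iff]
    refine measure_null_of_locally_null _ fun t₀ _ => ?_
    have hK : IsCompact ((fun t => G.mul x (G.expCurve j t)) '' Icc (t₀ - 1) (t₀ + 1)) :=
      isCompact_Icc.image ((continuous_mul_expCurve j).comp
        (continuous_const.prodMk continuous_id))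
    obtain ⟨ε, hε, C, hC, h⟩ := hu.exists_flow_bound hr hj hK
    set δ := min 1 (ε / 2)
    have hδ : 0 < δ := by positivity
    have hLip : LipschitzOnWith (Real.toNNReal C) (fun t => u (G.mul x (G.expCurve j t)))
        (Ioo (t₀ - δ) (t₀ + δ)) := by
      refine LipschitzOnWith.of_dist_le_mul fun s hs t ht => ?_
      have h1 : δ ≤ 1 := min_le_left _ _
      have h2 : δ ≤ ε / 2 := min_le_right _ _
      have h3 := h (G.mul x (G.expCurve j t)) ⟨t, ⟨by linarith [ht.1], by linarith [ht.2]⟩, rfl⟩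
        (s - t) (by rw [abs_lt]; constructor <;> linarith [ht.1, ht.2, hs.1, hs.2])
      rw [G.mul_assoc, ← G.expCurve_add, add_sub_cancel] at h3
      rwa [Real.dist_eq, Real.dist_eq, Real.coe_toNNReal _ hC.le]
    refine ⟨_, inter_mem_nhdsWithin _ (Ioo_mem_nhds (a := t₀ - δ) (b := t₀ + δ)
      (by linarith) (by linarith)), ?_⟩
    have h1 := hLip.ae_differentiableWithinAt_of_mem_real
    rw [ae_iff] at h1
    refine measure_mono_null ?_ h1
    intro t ht hdiff
    exact ht.1 ((hdiff ht.2).differentiableAt (Ioo_mem_nhds ht.2.1 ht.2.2))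
  have hshift : ∀ x t, G.CurveDifferentiableAt j u (G.mul x (G.expCurve j t)) ↔
      DifferentiableAt ℝ (fun t => u (G.mul x (G.expCurve j t))) t := by
    intro x t
    simp only [CurveDifferentiableAt, G.mul_assoc, ← G.expCurve_add]
    have := differentiableAt_iff_comp_const_add (𝕜 := ℝ)
      (f := fun s => u (G.mul x (G.expCurve j s))) (a := t) (b := t)
    simpa using this.symm
  have hmeas : MeasurableSet {p : (Fin n → ℝ) × ℝ |
      G.CurveDifferentiableAt j u (G.mul p.1 (G.expCurve j p.2))} :=
    (continuous_mul_expCurve j).measurable (measurableSet_curveDifferentiableAt j hcont)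
  have h1 : ∀ᵐ x, ∀ᵐ t : ℝ, G.CurveDifferentiableAt j u (G.mul x (G.expCurve j t)) :=
    Eventually.of_forall fun x => (hline x).mono fun t ht => (hshift x t).2 ht
  obtain ⟨t, ht⟩ := ((Measure.ae_ae_comm hmeas).1 h1).exists
  filter_upwards [(G.measurePreserving_mul_right
    (G.inv (G.expCurve j t))).quasiMeasurePreserving.ae ht] with x hx
  rwa [G.inv_mul_cancel_right] at hx

/-- Difference quotients along the flow of `X_j` converge to the pointwise derivative when
integrated against a continuous function, provided that the integrands live on a fixed compact
set. -/
lemma IsLipLoc.tendsto_integral_quotient (hr : G.IsHomogeneousNorm r) {u : (Fin n → ℝ) → ℝ}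
    (hu : G.IsLipLoc r u) {j : Fin n} (hj : G.weight j = 1) {ψ : (Fin n → ℝ) → ℝ}
    (hψ : Continuous ψ) {K : Set (Fin n → ℝ)} (hK : IsCompact K)
    (hsupp : ∀ t, |t| < 1 → ∀ x, x ∉ K → (u (G.mul x (G.expCurve j t)) - u x) * ψ x = 0) :
    Tendsto (fun t : ℝ => ∫ x, t⁻¹ * ((u (G.mul x (G.expCurve j t)) - u x) * ψ x)) (𝓝[≠] 0)
      (𝓝 (∫ x, G.curveDeriv j u x * ψ x)) := by
  have hcont := hu.continuous hr
  obtain ⟨ε, hε, C, hC, h⟩ := hu.exists_flow_bound hr hj hK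
  refine tendsto_integral_filter_of_dominated_convergence
    (K.indicator fun x => C * |ψ x|) ?_ ?_ ?_ ?_
  · refine Eventually.of_forall fun t => Continuous.aestronglyMeasurable ?_
    have : Continuous fun x => u (G.mul x (G.expCurve j t)) :=
      hcont.comp (G.continuous_mul continuous_id continuous_const)
    fun_prop
  · have : ∀ᶠ t : ℝ in 𝓝[≠] 0, (|t| < ε ∧ |t| < 1) ∧ t ≠ 0 := by
      filter_upwards [self_mem_nhdsWithin,
        mem_nhdsWithin_of_mem_nhds (Metric.ball_mem_nhds (0 : ℝ) hε),
        mem_nhdsWithin_of_mem_nhds (Metric.ball_mem_nhds (0 : ℝ) one_pos)] with t h1 h2 h3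
      exact ⟨⟨by simpa using h2, by simpa using h3⟩, h1⟩
    filter_upwards [this] with t ht
    refine Eventually.of_forall fun x => ?_
    by_cases hx : x ∈ K
    · rw [norm_mul, norm_mul, norm_inv, Real.norm_eq_abs, Real.norm_eq_abs, Real.norm_eq_abs,
        indicator_of_mem hx, inv_mul_le_iff₀ (abs_pos.2 ht.2)]
      calc _ ≤ C * |t| * |ψ x| := by gcongr; exact h x hx t ht.1.1
        _ = _ := by ring
    · simp [hx, hsupp t ht.1.2 x hx]
  · exact (integrable_indicator_iff hK.measurableSet).2
      ((hψ.abs.const_mul C).continuousOn.integrableOn_compact hK)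
  · filter_upwards [hu.ae_curveDifferentiableAt hr hj] with x hx
    have := hx.hasDerivAt.tendsto_slope_zero
    simp only [zero_add, mul_expCurve_zero, smul_eq_mul] at this
    refine (this.mul_const (ψ x)).congr fun t => ?_
    exact _root_.mul_assoc _ _ _

/-- Integration by parts, from the invariance of the Lebesgue measure under the flow. -/
lemma IsLipLoc.integral_mul_curveDeriv (hr : G.IsHomogeneousNorm r) {u : (Fin n → ℝ) → ℝ}
    (hu : G.IsLipLoc r u) {j : Fin n} (hj : G.weight j = 1) {ψ : (Fin n → ℝ) → ℝ}
    (hψ : G.IsLipLoc r ψ) (hc : HasCompactSupport ψ) :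
    ∫ x, u x * G.curveDeriv j ψ x = - ∫ x, G.curveDeriv j u x * ψ x := by
  have hucont := hu.continuous hr
  have hψcont := hψ.continuous hr
  -- `K'` contains the supports of all the translates of `ψ` along the flow for times `|t| ≤ 1`
  set K' := (fun p : (Fin n → ℝ) × ℝ => G.mul p.1 (G.expCurve j p.2)) ''
    (tsupport ψ ×ˢ Icc (-1) 1)
  have hK'c : IsCompact K' := (hc.prod isCompact_Icc).image (continuous_mul_expCurve j)
  have h1 := hu.tendsto_integral_quotient hr hj hψcont hc
    (fun t _ x hx => by simp [image_eq_zero_of_notMem_tsupport hx])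
  have h2 := hψ.tendsto_integral_quotient hr hj hucont hK'c (fun t ht x hx => by
    rw [abs_lt] at ht
    have hx0 : x ∉ tsupport ψ := fun h => hx ⟨(x, 0), ⟨h, by simp⟩, mul_expCurve_zero j x⟩
    have hxt : G.mul x (G.expCurve j t) ∉ tsupport ψ := fun h => hx
      ⟨(G.mul x (G.expCurve j t), -t), ⟨h, by constructor <;> simp <;> linarith [ht.1, ht.2]⟩, by
        simp [G.expCurve_neg, G.mul_inv_cancel_right]⟩
    simp [image_eq_zero_of_notMem_tsupport hx0, image_eq_zero_of_notMem_tsupport hxt])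
  have hneg : Tendsto (fun t : ℝ => -t) (𝓝[≠] 0) (𝓝[≠] 0) := by
    refine tendsto_nhdsWithin_iff.2 ⟨?_, ?_⟩
    · simpa using (continuous_neg.tendsto (0 : ℝ)).mono_left nhdsWithin_le_nhds
    · filter_upwards [self_mem_nhdsWithin] with t ht using neg_ne_zero.2 ht
  have h3 := (h2.comp hneg).neg
  -- the change of variables `x ↦ x ∘ exp (-t X_j)` moves the difference quotient onto `ψ`
  have heq : ∀ t : ℝ, -∫ x, (-t)⁻¹ * ((ψ (G.mul x (G.expCurve j (-t))) - ψ x) * u x) =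
      ∫ x, t⁻¹ * ((u (G.mul x (G.expCurve j t)) - u x) * ψ x) := by
    intro t
    have hut : Continuous fun x => u (G.mul x (G.expCurve j t)) :=
      hucont.comp (G.continuous_mul continuous_id continuous_const)
    have hi1 : Integrable fun x => u (G.mul x (G.expCurve j t)) * ψ x :=
      (hut.mul hψcont).integrable_of_hasCompactSupport hc.mul_left
    have hi2 : Integrable fun x => u x * ψ x :=
      (hucont.mul hψcont).integrable_of_hasCompactSupport hc.mul_left
    have hshift : ∀ x, u (G.mul (G.mul x (G.expCurve j (-t))) (G.expCurve j t)) *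
        ψ (G.mul x (G.expCurve j (-t))) = u x * ψ (G.mul x (G.expCurve j (-t))) := fun x => by
      rw [G.expCurve_neg, G.inv_mul_cancel_right]
    have hi3 : Integrable fun x => u x * ψ (G.mul x (G.expCurve j (-t))) := by
      have := (G.measurePreserving_mul_right (G.expCurve j (-t))).integrable_comp_of_integrable hi1
      simpa only [Function.comp_def, hshift] using this
    have e1 : ∫ x, u (G.mul x (G.expCurve j t)) * ψ x =
        ∫ x, u x * ψ (G.mul x (G.expCurve j (-t))) := by
      rw [← G.integral_mul_right _ (G.expCurve j (-t))]
      simp only [hshift]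
    rw [integral_const_mul, integral_const_mul]
    simp only [sub_mul]
    rw [integral_sub hi1 hi2, e1]
    simp only [mul_comm (ψ _) (u _)]
    rw [integral_sub hi3 hi2, inv_neg]; ring
  have h4 : Tendsto (fun t : ℝ => ∫ x, t⁻¹ * ((u (G.mul x (G.expCurve j t)) - u x) * ψ x)) (𝓝[≠] 0)
      (𝓝 (-∫ x, G.curveDeriv j ψ x * u x)) := by
    refine h3.congr fun t => heq t
  have h5 := tendsto_nhds_unique h1 h4
  rw [h5, neg_neg]
  simp only [mul_comm]

/-- The pointwise derivative along the flow is the weak derivative. -/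
lemma IsLipLoc.isWeakDeriv_curveDeriv (hr : G.IsHomogeneousNorm r) {u : (Fin n → ℝ) → ℝ}
    (hu : G.IsLipLoc r u) (j : G.HIndex) : G.IsWeakDeriv j u (G.curveDeriv j.1 u) := by
  have hcont := hu.continuous hr
  refine ⟨hcont.locallyIntegrable, ?_, fun ψ hψ hc => ?_⟩
  · refine (locallyIntegrable_iff).2 fun K hK => ?_
    obtain ⟨C, hC, h⟩ := hu.exists_curveDeriv_bound hr j.2 hK
    refine Measure.integrableOn_of_bounded (M := C) hK.measure_lt_top.ne
      (measurable_curveDeriv j.1 hcont).aestronglyMeasurable ?_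
    exact (ae_restrict_iff' hK.measurableSet).2 (Eventually.of_forall fun x hx => h x hx)
  · rw [← hu.integral_mul_curveDeriv hr j.2 (isLipLoc_of_contDiff hr hψ) hc]
    refine integral_congr_ae (Eventually.of_forall fun x => ?_)
    have h1 := hasDerivAt_comp_expCurve_of_differentiable (G := G) (j := j.1)
      (hψ.differentiable (by simp)) x
    simp only [curveDeriv, h1.deriv]; rfl

lemma IsLipLoc.weakDeriv_ae_eq (hr : G.IsHomogeneousNorm r) {u : (Fin n → ℝ) → ℝ}
    (hu : G.IsLipLoc r u) (j : G.HIndex) :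
    G.weakDeriv j u =ᵐ[volume] G.curveDeriv j.1 u := by
  have h : ∃ g, G.IsWeakDeriv j u g := ⟨_, hu.isWeakDeriv_curveDeriv hr j⟩
  have h1 : G.IsWeakDeriv j u (G.weakDeriv j u) := by
    rw [weakDeriv, dif_pos h]; exact h.choose_spec
  have h2 := hu.isWeakDeriv_curveDeriv hr j
  refine ae_eq_of_integral_contDiff_smul_eq h1.2.1 h2.2.1 fun g hg hgc => ?_
  have e := (h1.2.2 g hg hgc).symm.trans (h2.2.2 g hg hgc)
  simpa [mul_comm] using neg_injective e

/-! ### Functions with vanishing horizontal gradient -/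

variable (G) in
/-- The group convolution `ρ * u`, which regularizes `u` and commutes with the left-invariant
fields acting on `u`. -/
noncomputable def groupConv (ρ u : (Fin n → ℝ) → ℝ) (x : Fin n → ℝ) : ℝ :=
  ∫ y, ρ (G.mul x (G.inv y)) * u y

lemma hasCompactSupport_mul_inv {ρ : (Fin n → ℝ) → ℝ} (hρ : HasCompactSupport ρ)
    (x : Fin n → ℝ) : HasCompactSupport fun y => ρ (G.mul x (G.inv y)) := by
  refine HasCompactSupport.intro (K := (fun z => G.mul (G.inv z) x) '' tsupport ρ)
    (hρ.image (G.continuous_mul (G.continuous_inv continuous_id) continuous_const)) fun y hy => ?_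
  by_contra h
  refine hy ⟨G.mul x (G.inv y), subset_tsupport _ h, ?_⟩
  simp [G.inv_mul_rev, G.inv_inv, G.mul_assoc, G.inv_mul, G.mul_zero]

/-- Smoothness follows from the smoothness of Euclidean convolutions depending on a parameter,
the convolution being evaluated at `0`. -/
lemma contDiff_groupConv {ρ u : (Fin n → ℝ) → ℝ} (hρ : ContDiff ℝ (⊤ : ℕ∞) ρ)
    (hρc : HasCompactSupport ρ) (hu : Continuous u) :
    ContDiff ℝ (⊤ : ℕ∞) (G.groupConv ρ u) := by
  refine contDiff_iff_contDiffAt.2 fun x => ?_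
  set s := Metric.ball (0 : Fin n → ℝ) (‖x‖ + 1)
  set g : (Fin n → ℝ) → (Fin n → ℝ) → ℝ := fun p z => ρ (G.mul p (G.inv (-z))) with hg
  set k : Set (Fin n → ℝ) := (fun q : (Fin n → ℝ) × (Fin n → ℝ) => -(G.mul (G.inv q.1) q.2)) ''
    (tsupport ρ ×ˢ Metric.closedBall 0 (‖x‖ + 1))
  have hk : IsCompact k := (hρc.isCompact.prod (isCompact_closedBall _ _)).image
    (G.continuous_mul (G.continuous_inv continuous_fst) continuous_snd).neg
  have h := contDiffOn_convolution_right_with_param_comp (n := (⊤ : ℕ∞)) (μ := volume)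
    (ContinuousLinearMap.mul ℝ ℝ) (s := s) (f := u) (g := g) (v := fun _ => 0) (k := k)
    contDiffOn_const Metric.isOpen_ball hk ?_ hu.locallyIntegrable ?_
  · have h2 := h.contDiffAt
      (Metric.isOpen_ball.mem_nhds (mem_ball_zero_iff.2 (by linarith) : x ∈ s))
    refine h2.congr_of_eventuallyEq (Eventually.of_forall fun p => ?_)
    simp [groupConv, convolution, hg, mul_comm]
  · intro p z hp hz
    by_contra hne
    refine hz ⟨(G.mul p (G.inv (-z)), p), ⟨subset_tsupport _ hne, ?_⟩, ?_⟩
    · exact Metric.ball_subset_closedBall hp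
    · simp [G.inv_mul_rev, G.inv_inv, G.mul_assoc, G.inv_mul, G.mul_zero]
  · exact (hρ.comp (G.contDiff_mul_comp contDiff_fst
      (G.contDiff_inv.comp contDiff_snd.neg))).contDiffOn

lemma fderiv_groupConv_eq_zero (hr : G.IsHomogeneousNorm r) {ρ u : (Fin n → ℝ) → ℝ}
    (hρ : ContDiff ℝ (⊤ : ℕ∞) ρ) (hρc : HasCompactSupport ρ) (hu : G.IsLipLoc r u) {j : Fin n}
    (hj : G.weight j = 1) (h0 : G.curveDeriv j u =ᵐ[volume] 0) (x : Fin n → ℝ) :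
    fderiv ℝ (G.groupConv ρ u) x (leftInvField G.mul j x) = 0 := by
  have hcont := hu.continuous hr
  have h1 := hasDerivAt_comp_expCurve_of_differentiable (G := G) (j := j)
    ((contDiff_groupConv (G := G) hρ hρc hcont).differentiable (by simp)) x
  have hρx : Continuous fun y => ρ (G.mul x (G.inv y)) :=
    hρ.continuous.comp (G.continuous_mul continuous_const (G.continuous_inv continuous_id))
  have hρxc := hasCompactSupport_mul_inv (G := G) hρc x
  have h2 := hu.tendsto_integral_quotient hr hj hρx hρxc
    (fun t _ y hy => by simp only [image_eq_zero_of_notMem_tsupport hy, MulZeroClass.mul_zero])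
  have hzero : ∫ y, G.curveDeriv j u y * ρ (G.mul x (G.inv y)) = 0 := by
    rw [integral_eq_zero_of_ae]
    filter_upwards [h0] with y hy
    simp [hy]
  rw [hzero] at h2
  have h3 := h1.tendsto_slope_zero
  refine tendsto_nhds_unique h3 (h2.congr fun t => ?_)
  have hut : Continuous fun y => u (G.mul y (G.expCurve j t)) :=
    hcont.comp (G.continuous_mul continuous_id continuous_const)
  have e1 : G.groupConv ρ u (G.mul x (G.expCurve j t)) =
      ∫ y, u (G.mul y (G.expCurve j t)) * ρ (G.mul x (G.inv y)) := by
    rw [groupConv, ← G.integral_mul_right _ (G.expCurve j t)]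
    refine integral_congr_ae (Eventually.of_forall fun y => ?_)
    simp only [G.inv_mul_rev, G.mul_assoc, G.mul_inv_cancel_left, mul_comm]
  simp only [zero_add, mul_expCurve_zero, smul_eq_mul]
  rw [e1, groupConv, integral_const_mul]
  simp only [sub_mul, mul_comm (ρ _)]
  rw [integral_sub (f := fun y => u (G.mul y (G.expCurve j t)) * ρ (G.mul x (G.inv y)))
    (g := fun y => u y * ρ (G.mul x (G.inv y)))
    ((hut.mul hρx).integrable_of_hasCompactSupport hρxc.mul_left)
    ((hcont.mul hρx).integrable_of_hasCompactSupport hρxc.mul_left)]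

/-- A smooth function annihilated by the horizontal fields is annihilated by their iterated
brackets. -/
lemma fderiv_eq_zero_of_isIteratedBracket {S : Set ((Fin n → ℝ) → (Fin n → ℝ))}
    {w : (Fin n → ℝ) → ℝ} (hw : ContDiff ℝ (⊤ : ℕ∞) w)
    (hS : ∀ V ∈ S, ContDiff ℝ (⊤ : ℕ∞) V ∧ ∀ x, fderiv ℝ w x (V x) = 0)
    {V : (Fin n → ℝ) → (Fin n → ℝ)} (hV : IsIteratedBracket S V) :
    ContDiff ℝ (⊤ : ℕ∞) V ∧ ∀ x, fderiv ℝ w x (V x) = 0 := by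
  have hDw : ContDiff ℝ (⊤ : ℕ∞) (fderiv ℝ w) := hw.fderiv_right (by simp)
  induction hV with
  | base V hV => exact hS V hV
  | bracket V W _ _ ihV ihW =>
    obtain ⟨hV, hV0⟩ := ihV
    obtain ⟨hW, hW0⟩ := ihW
    have hDV : ContDiff ℝ (⊤ : ℕ∞) (fderiv ℝ V) := hV.fderiv_right (by simp)
    have hDW : ContDiff ℝ (⊤ : ℕ∞) (fderiv ℝ W) := hW.fderiv_right (by simp)
    refine ⟨(hDW.clm_apply hV).sub (hDV.clm_apply hW), fun x => ?_⟩
    have key : ∀ (Y : (Fin n → ℝ) → (Fin n → ℝ)), ContDiff ℝ (⊤ : ℕ∞) Y →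
        (∀ x, fderiv ℝ w x (Y x) = 0) → ∀ z,
        fderiv ℝ (fderiv ℝ w) x z (Y x) + fderiv ℝ w x (fderiv ℝ Y x z) = 0 := by
      intro Y hY hY0 z
      have h1 : HasFDerivAt (fun x => fderiv ℝ w x (Y x)) _ x :=
        ((hDw.differentiable (by simp) x).hasFDerivAt).clm_apply
          ((hY.differentiable (by simp) x).hasFDerivAt)
      have h2 : HasFDerivAt (fun x => fderiv ℝ w x (Y x))
          (0 : (Fin n → ℝ) →L[ℝ] ℝ) x := by
        simp only [hY0]; exact hasFDerivAt_const _ _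
      have h3 := DFunLike.congr_fun (h1.unique h2) z
      simp at h3
      linarith
    have hs : IsSymmSndFDerivAt ℝ w x :=
      hw.contDiffAt.isSymmSndFDerivAt (by simp; exact WithTop.coe_le_coe.2 le_top)
    have e1 := key V hV hV0 (W x)
    have e2 := key W hW hW0 (V x)
    have e3 := hs.eq (V x) (W x)
    rw [VectorField.lieBracket, map_sub]
    linarith

/-- A locally Lipschitz function whose horizontal derivatives vanish almost everywhere is constant:
its group convolutions are smooth and annihilated by the horizontal fields, hence constant by
bracket generation. -/
lemma IsLipLoc.eq_of_curveDeriv_ae_zero (hr : G.IsHomogeneousNorm r) {u : (Fin n → ℝ) → ℝ}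
    (hu : G.IsLipLoc r u) (h0 : ∀ j, G.weight j = 1 → G.curveDeriv j u =ᵐ[volume] 0)
    (x y : Fin n → ℝ) : u x = u y := by
  have hcont := hu.continuous hr
  by_contra hne
  wlog hlt : u y < u x generalizing x y
  · exact this y x (Ne.symm hne) (lt_of_le_of_ne (not_lt.1 hlt) hne)
  obtain ⟨c, hc1, hc2⟩ := exists_between hlt
  -- `v` is positive near `x` and negative near `y`, and so are its convolutions with narrow bumps
  set v : (Fin n → ℝ) → ℝ := fun z => u z - c
  have hvcont : Continuous v := hcont.sub continuous_const
  have hv : G.IsLipLoc r v := hu.comp hr (h := fun s => s - c)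
    (LipschitzWith.id.sub (LipschitzWith.const c)).locallyLipschitz
  have hv0 : ∀ j, G.weight j = 1 → G.curveDeriv j v =ᵐ[volume] 0 := fun j hj => by
    have : G.curveDeriv j v = G.curveDeriv j u := by
      ext z; simp [curveDeriv, v]
    rw [this]; exact h0 j hj
  have hnear : ∀ z, Tendsto (fun ζ => G.mul (G.inv ζ) z) (𝓝 0) (𝓝 z) := fun z => by
    have : Continuous fun ζ => G.mul (G.inv ζ) z :=
      G.continuous_mul (G.continuous_inv continuous_id) continuous_const
    simpa [G.inv_zero, G.zero_mul] using this.tendsto 0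
  have hx : ∀ᶠ ζ in 𝓝 (0 : Fin n → ℝ), 0 < v (G.mul (G.inv ζ) x) :=
    ((hvcont.tendsto x).comp (hnear x)).eventually_const_lt (by simp [v, hc2])
  have hy : ∀ᶠ ζ in 𝓝 (0 : Fin n → ℝ), v (G.mul (G.inv ζ) y) < 0 :=
    ((hvcont.tendsto y).comp (hnear y)).eventually_lt_const (by simp [v, hc1])
  obtain ⟨ε, hε, hball⟩ := Metric.eventually_nhds_iff_ball.1 (hx.and hy)
  let ρ : ContDiffBump (0 : Fin n → ℝ) := ⟨ε / 2, ε, by positivity, by linarith⟩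
  have hρ : ContDiff ℝ (⊤ : ℕ∞) ρ := ρ.contDiff
  have hρc : HasCompactSupport ρ := ρ.hasCompactSupport
  have hw := contDiff_groupConv (G := G) hρ hρc hvcont
  have hX : ∀ z V, IsIteratedBracket {Y | ∃ j, G.weight j = 1 ∧ Y = leftInvField G.mul j} V →
      fderiv ℝ (G.groupConv ρ v) z (V z) = 0 := by
    intro z V hV
    refine (fderiv_eq_zero_of_isIteratedBracket hw ?_ hV).2 z
    rintro Y ⟨j, hj, rfl⟩
    exact ⟨G.contDiff_leftInvField j, fderiv_groupConv_eq_zero hr hρ hρc hv hj (hv0 j hj)⟩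
  have hD : ∀ z, fderiv ℝ (G.groupConv ρ v) z = 0 := by
    intro z
    ext1 a
    have ha : a ∈ Submodule.span ℝ {v | ∃ V, IsIteratedBracket
        {Y | ∃ j, G.weight j = 1 ∧ Y = leftInvField G.mul j} V ∧ V z = v} := by
      rw [G.bracket_generating z]; trivial
    have hle : Submodule.span ℝ {v | ∃ V, IsIteratedBracket
        {Y | ∃ j, G.weight j = 1 ∧ Y = leftInvField G.mul j} V ∧ V z = v} ≤
        LinearMap.ker (fderiv ℝ (G.groupConv ρ v) z).toLinearMap := by
      refine Submodule.span_le.2 ?_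
      rintro _ ⟨V, hV, rfl⟩
      exact hX z V hV
    exact hle ha
  have hconst := is_const_of_fderiv_eq_zero (hw.differentiable (by simp)) hD x y
  have hsupp : ∀ z ζ : Fin n → ℝ, ρ (G.mul z (G.inv ζ)) ≠ 0 →
      ∃ η ∈ Metric.ball (0 : Fin n → ℝ) ε, ζ = G.mul (G.inv η) z := by
    intro z ζ h
    refine ⟨G.mul z (G.inv ζ), ?_, ?_⟩
    · have : G.mul z (G.inv ζ) ∈ Function.support ρ := h
      rwa [ρ.support_eq] at this
    · simp [G.inv_mul_rev, G.inv_inv, G.mul_assoc, G.inv_mul, G.mul_zero]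
  have hρcont : ∀ z, Continuous fun ζ => ρ (G.mul z (G.inv ζ)) := fun z =>
    hρ.continuous.comp (G.continuous_mul continuous_const (G.continuous_inv continuous_id))
  have hρ0 : ∀ z, ρ (G.mul z (G.inv z)) = 1 := fun z => by
    rw [G.mul_inv]
    exact ρ.one_of_mem_closedBall (Metric.mem_closedBall_self ρ.rIn_pos.le)
  have hposx : 0 < G.groupConv ρ v x := by
    refine Continuous.integral_pos_of_hasCompactSupport_nonneg_nonzero (x := x)
      ((hρcont x).mul hvcont) (hasCompactSupport_mul_inv hρc x).mul_right ?_ ?_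
    · intro ζ
      by_cases h : ρ (G.mul x (G.inv ζ)) = 0
      · simp [h]
      · obtain ⟨η, hη, rfl⟩ := hsupp x ζ h
        exact mul_nonneg ρ.nonneg (hball η hη).1.le
    · simp only [hρ0, one_mul, v]; linarith
  have hnegy : 0 < - G.groupConv ρ v y := by
    rw [groupConv, ← integral_neg]
    refine Continuous.integral_pos_of_hasCompactSupport_nonneg_nonzero (x := y)
      ((hρcont y).mul hvcont).neg (hasCompactSupport_mul_inv hρc y).mul_right.neg ?_ ?_
    · intro ζ
      by_cases h : ρ (G.mul y (G.inv ζ)) = 0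
      · simp [h]
      · obtain ⟨η, hη, rfl⟩ := hsupp y ζ h
        exact neg_nonneg.2 (mul_nonpos_of_nonneg_of_nonpos ρ.nonneg (hball η hη).2.le)
    · simp only [hρ0, one_mul, v]; intro h; linarith
  linarith

end HomogeneousCarnotGroup

/-! ### The pointwise inequality absorbing the cut-off term -/

/-- The term produced by the gradient of the cut-off is absorbed, up to an error `K * R ^ (-D)`, by
the diffusion term and the source term. If neither of them dominates it, then `ψ * t ≲ v / R` and
`v ^ (ω - a) * ψ ^ (1 + a) ≲ R ^ (μ - 1 - a)`; the growth `Φ ≲ t ^ (p - 1)` and the large power of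
`ψ` turn this into decay in `R`. -/
lemma exists_cutoff_absorption {k q : ℕ} {p a μ ω c C' L M D : ℝ} (hp : 1 < p) (ha : 0 ≤ a)
    (haω : a < ω) (hc : 0 < c) (hC' : 0 < C') (hL : 0 < L) (hM : 0 < M) (hq : 1 ≤ q)
    (hk : p + (1 + a) * ((q + p - 1) / (ω - a)) ≤ k)
    (hD : D ≤ p + (1 + a - μ) * ((q + p - 1) / (ω - a))) :
    ∃ K, 0 < K ∧ ∀ R ψ v t Φ g : ℝ, 1 ≤ R → 0 < ψ → ψ ≤ 1 → 0 < v → 0 < t → 0 ≤ Φ →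
      Φ ≤ C' * t ^ (p - 1) → 0 ≤ g → g ≤ L / R →
      k * ψ ^ (k - 1) * v ^ q * Φ * g ≤ 1 / 2 * (ψ ^ k * (q * v ^ (q - 1)) * Φ * t) +
        c * (M * R) ^ (-μ) * v ^ ω * (Φ / t ^ a) * (ψ ^ k * v ^ q) + K * R ^ (-D) := by
  set N := (q + p - 1) / (ω - a) with hN
  have hσ : 0 < ω - a := by linarith
  have hq1 : (1 : ℝ) ≤ q := by exact_mod_cast hq
  have hN0 : 0 < N := div_pos (by linarith) hσ
  have hkp : p ≤ k := by
    have : 0 ≤ (1 + a) * N := by positivity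
    linarith
  have hk1 : 1 ≤ k := by
    have : (1 : ℝ) < k := by linarith
    exact_mod_cast this.le
  have hk0 : (0 : ℝ) < k := by linarith
  set K₁ := 2 * k * L
  have hK₁ : 0 < K₁ := by positivity
  set K₂ := k * L * K₁ ^ a * M ^ μ / c
  have hK₂ : 0 < K₂ := by positivity
  refine ⟨k * C' * L * K₁ ^ (p - 1) * K₂ ^ N, by positivity, ?_⟩
  intro R ψ v t Φ g hR hψ hψ1 hv ht hΦ hΦt hg hgL
  have hR0 : 0 < R := by linarith
  have hψk : ψ ^ k = ψ ^ (k - 1) * ψ := by rw [← pow_succ]; congr 1; omega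
  have hvq : v ^ q = v ^ (q - 1) * v := by rw [← pow_succ]; congr 1; omega
  have herr : 0 ≤ k * C' * L * K₁ ^ (p - 1) * K₂ ^ N * R ^ (-D) := by positivity
  have hA : 0 ≤ 1 / 2 * (ψ ^ k * (q * v ^ (q - 1)) * Φ * t) := by positivity
  have hB : 0 ≤ c * (M * R) ^ (-μ) * v ^ ω * (Φ / t ^ a) * (ψ ^ k * v ^ q) := by positivity
  by_cases h1 : k * v * g ≤ 1 / 2 * (ψ * q * t)
  · have : k * ψ ^ (k - 1) * v ^ q * Φ * g ≤ 1 / 2 * (ψ ^ k * (q * v ^ (q - 1)) * Φ * t) := by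
      calc _ = (ψ ^ (k - 1) * v ^ (q - 1) * Φ) * (k * v * g) := by rw [hvq]; ring
        _ ≤ (ψ ^ (k - 1) * v ^ (q - 1) * Φ) * (1 / 2 * (ψ * q * t)) := by gcongr
        _ = _ := by rw [hψk]; ring
    linarith
  by_cases h2 : k * g ≤ c * (M * R) ^ (-μ) * v ^ ω / t ^ a * ψ
  · have : k * ψ ^ (k - 1) * v ^ q * Φ * g ≤
        c * (M * R) ^ (-μ) * v ^ ω * (Φ / t ^ a) * (ψ ^ k * v ^ q) := by
      calc _ = (ψ ^ (k - 1) * v ^ q * Φ) * (k * g) := by ring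
        _ ≤ (ψ ^ (k - 1) * v ^ q * Φ) * (c * (M * R) ^ (-μ) * v ^ ω / t ^ a * ψ) := by gcongr
        _ = _ := by rw [hψk]; ring
    linarith
  -- neither term dominates: `h1` bounds `ψ * t` from above, `h2` bounds `t ^ a` from below
  push Not at h1 h2
  have hτ : ψ * t ≤ K₁ * v / R := by
    have e : ψ * t ≤ ψ * q * t := by
      have : ψ * t * 1 ≤ ψ * t * q := by gcongr
      linarith
    have e2 : k * v * g ≤ k * v * (L / R) := by gcongr
    have e3 : K₁ * v / R = 2 * (k * v * (L / R)) := by simp only [K₁]; ring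
    rw [e3]; linarith
  have hvψ : v ^ (ω - a) * ψ ^ (1 + a) ≤ K₂ * R ^ (μ - 1 - a) := by
    have e1 : c * (M * R) ^ (-μ) * v ^ ω * ψ ≤ k * (L / R) * t ^ a := by
      have : c * (M * R) ^ (-μ) * v ^ ω / t ^ a * ψ * t ^ a ≤ k * (L / R) * t ^ a := by
        have : k * g ≤ k * (L / R) := by gcongr
        exact mul_le_mul_of_nonneg_right (h2.le.trans this) (by positivity)
      rwa [show c * (M * R) ^ (-μ) * v ^ ω / t ^ a * ψ * t ^ a =
        c * (M * R) ^ (-μ) * v ^ ω * ψ from by field_simp] at this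
    have e2 : c * (M * R) ^ (-μ) * v ^ ω * ψ * ψ ^ a ≤ k * (L / R) * (K₁ * v / R) ^ a := by
      calc _ ≤ k * (L / R) * t ^ a * ψ ^ a := by gcongr
        _ = k * (L / R) * (ψ * t) ^ a := by rw [Real.mul_rpow hψ.le ht.le]; ring
        _ ≤ _ := by gcongr
    have e3 : (K₁ * v / R) ^ a = K₁ ^ a * v ^ a * R ^ (-a) := by
      rw [Real.div_rpow (by positivity) hR0.le, Real.mul_rpow hK₁.le hv.le, Real.rpow_neg hR0.le]
      rfl
    have e4 : (M * R) ^ (-μ) = (M ^ μ)⁻¹ * R ^ (-μ) := by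
      rw [Real.mul_rpow hM.le hR0.le, Real.rpow_neg hM.le]
    have e5 : v ^ ω = v ^ (ω - a) * v ^ a := by rw [← Real.rpow_add hv]; ring_nf
    have e6 : ψ * ψ ^ a = ψ ^ (1 + a) := by rw [Real.rpow_add hψ, Real.rpow_one]
    have e7 : R ^ (μ - 1 - a) = R ^ μ * R⁻¹ * R ^ (-a) := by
      rw [← Real.rpow_neg_one, ← Real.rpow_add hR0, ← Real.rpow_add hR0]; ring_nf
    have e8 : R ^ μ * R ^ (-μ) = 1 := by rw [← Real.rpow_add hR0]; simp
    rw [e3, e4, e5, _root_.mul_assoc _ ψ, e6] at e2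
    have hf : 0 < M ^ μ * R ^ μ / (c * v ^ a) := by positivity
    have e9 := mul_le_mul_of_nonneg_left e2 hf.le
    have hva : v ^ a ≠ 0 := by positivity
    calc v ^ (ω - a) * ψ ^ (1 + a) = M ^ μ * R ^ μ / (c * v ^ a) *
          (c * ((M ^ μ)⁻¹ * R ^ (-μ)) * (v ^ (ω - a) * v ^ a) * ψ ^ (1 + a)) := by
          have : M ^ μ * R ^ μ / (c * v ^ a) *
            (c * ((M ^ μ)⁻¹ * R ^ (-μ)) * (v ^ (ω - a) * v ^ a) * ψ ^ (1 + a)) =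
            (R ^ μ * R ^ (-μ)) * (v ^ (ω - a) * ψ ^ (1 + a)) := by field_simp
          rw [this, e8, one_mul]
      _ ≤ _ := e9
      _ = K₂ * R ^ (μ - 1 - a) := by
          rw [e7]; simp only [K₂]; field_simp
  have htp : t ^ (p - 1) ≤ (K₁ * v / R) ^ (p - 1) * ψ ^ (1 - p) := by
    have e1 : (ψ * t) ^ (p - 1) ≤ (K₁ * v / R) ^ (p - 1) := by gcongr
    rw [Real.mul_rpow hψ.le ht.le] at e1
    have e2 : ψ ^ (p - 1) * ψ ^ (1 - p) = 1 := by rw [← Real.rpow_add hψ]; simp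
    calc t ^ (p - 1) = ψ ^ (p - 1) * t ^ (p - 1) * ψ ^ (1 - p) := by
          rw [mul_right_comm, e2, one_mul]
      _ ≤ _ := by gcongr
  have hpow : ψ ^ ((k : ℝ) - p) * v ^ ((q : ℝ) + p - 1) ≤ K₂ ^ N * R ^ ((μ - 1 - a) * N) := by
    have e1 : ψ ^ ((k : ℝ) - p) ≤ ψ ^ ((1 + a) * N) :=
      Real.rpow_le_rpow_of_exponent_ge hψ hψ1 (by linarith)
    have e2 : (ω - a) * N = q + p - 1 := by rw [hN]; field_simp
    calc _ ≤ ψ ^ ((1 + a) * N) * v ^ ((ω - a) * N) := by rw [e2]; gcongr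
      _ = (v ^ (ω - a) * ψ ^ (1 + a)) ^ N := by
          rw [Real.mul_rpow (by positivity) (by positivity), ← Real.rpow_mul hv.le,
            ← Real.rpow_mul hψ.le, mul_comm]
      _ ≤ (K₂ * R ^ (μ - 1 - a)) ^ N := by gcongr
      _ = _ := by rw [Real.mul_rpow hK₂.le (by positivity), ← Real.rpow_mul hR0.le]
  have hfinal : k * ψ ^ (k - 1) * v ^ q * Φ * g ≤
      k * C' * L * K₁ ^ (p - 1) * K₂ ^ N * R ^ (-D) := by
    calc k * ψ ^ (k - 1) * v ^ q * Φ * g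
        ≤ k * ψ ^ (k - 1) * v ^ q * (C' * ((K₁ * v / R) ^ (p - 1) * ψ ^ (1 - p))) * (L / R) := by
          have : Φ ≤ C' * ((K₁ * v / R) ^ (p - 1) * ψ ^ (1 - p)) := hΦt.trans (by gcongr)
          gcongr
      _ = k * C' * L * K₁ ^ (p - 1) * (ψ ^ ((k : ℝ) - p) * v ^ ((q : ℝ) + p - 1)) * R ^ (-p) := by
          have e1 : (K₁ * v / R) ^ (p - 1) = K₁ ^ (p - 1) * v ^ (p - 1) * R ^ (1 - p) := by
            rw [Real.div_rpow (by positivity) hR0.le, Real.mul_rpow hK₁.le hv.le, div_eq_mul_inv,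
              ← Real.rpow_neg hR0.le, neg_sub]
          have e2 : ψ ^ ((k : ℝ) - p) = ψ ^ (k - 1) * ψ ^ (1 - p) := by
            rw [← Real.rpow_natCast, ← Real.rpow_add hψ, Nat.cast_sub hk1]; congr 1; push_cast; ring
          have e3 : v ^ ((q : ℝ) + p - 1) = v ^ q * v ^ (p - 1) := by
            rw [← Real.rpow_natCast, ← Real.rpow_add hv]; ring_nf
          have e4 : R ^ (-p) = R ^ (1 - p) * R⁻¹ := by
            rw [← Real.rpow_neg_one, ← Real.rpow_add hR0]; ring_nf
          rw [e1, e2, e3, e4]; ring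
      _ ≤ k * C' * L * K₁ ^ (p - 1) * (K₂ ^ N * R ^ ((μ - 1 - a) * N)) * R ^ (-p) := by gcongr
      _ = k * C' * L * K₁ ^ (p - 1) * K₂ ^ N * R ^ ((μ - 1 - a) * N - p) := by
          rw [sub_eq_add_neg _ p, Real.rpow_add hR0]; ring
      _ ≤ _ := by
          have : R ^ ((μ - 1 - a) * N - p) ≤ R ^ (-D) :=
            Real.rpow_le_rpow_of_exponent_le hR (by nlinarith)
          gcongr
  linarith

lemma hasDerivAt_max_pow (γ : ℝ) (m : ℕ) (s : ℝ) :
    HasDerivAt (fun s => max (s - γ) 0 ^ (m + 2))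
      (((m + 2 : ℕ) : ℝ) * max (s - γ) 0 ^ (m + 1)) s := by
  rcases lt_trichotomy s γ with h | rfl | h
  · have e : (fun s => max (s - γ) 0 ^ (m + 2)) =ᶠ[𝓝 s] fun _ => (0 : ℝ) := by
      filter_upwards [eventually_lt_nhds h] with x hx
      rw [max_eq_right (by linarith)]; simp
    rw [max_eq_right (by linarith)]
    simpa using (hasDerivAt_const s (0 : ℝ)).congr_of_eventuallyEq e
  · have hO : (fun x : ℝ => max (x - s) 0 ^ (m + 2)) =O[𝓝 s] fun x => (x - s) ^ (m + 2) := by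
      refine Asymptotics.IsBigO.of_bound 1 (Eventually.of_forall fun x => ?_)
      rw [norm_pow, norm_pow, one_mul]
      gcongr
      rw [Real.norm_of_nonneg (le_max_right _ _)]
      exact max_le (le_abs_self _) (abs_nonneg _)
    have h0 : (fun x : ℝ => (x - s) ^ (m + 2)) =o[𝓝 s] fun x => x - s := by
      have := Asymptotics.isLittleO_pow_pow (𝕜 := ℝ) (m := 1) (n := m + 2) (by omega)
      have h1 : Tendsto (fun x : ℝ => x - s) (𝓝 s) (𝓝 0) := by
        have h2 : Continuous fun x : ℝ => x - s := by fun_prop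
        simpa using h2.tendsto s
      simpa [Function.comp_def] using this.comp_tendsto h1
    rw [hasDerivAt_iff_isLittleO]
    simpa using hO.trans_isLittleO h0
  · have e : (fun s => max (s - γ) 0 ^ (m + 2)) =ᶠ[𝓝 s] fun s => (s - γ) ^ (m + 2) := by
      filter_upwards [eventually_gt_nhds h] with x hx
      rw [max_eq_left (by linarith)]
    rw [max_eq_left (by linarith)]
    have := ((hasDerivAt_id s).sub_const γ).pow (m + 2)
    simpa using this.congr_of_eventuallyEq e

namespace HomogeneousCarnotGroup

variable {n : ℕ} {G : HomogeneousCarnotGroup n} {r : (Fin n → ℝ) → ℝ}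

/-! ### The pointwise horizontal gradient and the energy estimate -/

variable (G) in
/-- The horizontal gradient formed with the pointwise derivatives along the integral curves of the
fields `X_j`. -/
noncomputable def curveGrad (u : (Fin n → ℝ) → ℝ) (x : Fin n → ℝ) : EuclideanSpace ℝ G.HIndex :=
  WithLp.toLp 2 fun j => G.curveDeriv j.1 u x

lemma IsLipLoc.hgrad_ae_eq (hr : G.IsHomogeneousNorm r) {u : (Fin n → ℝ) → ℝ}
    (hu : G.IsLipLoc r u) : G.hgrad u =ᵐ[volume] G.curveGrad u := by
  have h : ∀ᵐ x, ∀ j : G.HIndex, G.weakDeriv j u x = G.curveDeriv j.1 u x :=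
    ae_all_iff.2 fun j => hu.weakDeriv_ae_eq hr j
  filter_upwards [h] with x hx
  simp only [hgrad, curveGrad, hx]

lemma measurable_curveGrad {u : (Fin n → ℝ) → ℝ} (hu : Continuous u) :
    Measurable (G.curveGrad u) :=
  (WithLp.measurable_toLp 2 _).comp
    (measurable_pi_lambda _ fun j => measurable_curveDeriv j.1 hu)

lemma IsLipLoc.exists_curveGrad_bound (hr : G.IsHomogeneousNorm r) {u : (Fin n → ℝ) → ℝ}
    (hu : G.IsLipLoc r u) {K : Set (Fin n → ℝ)} (hK : IsCompact K) :
    ∃ T, 0 < T ∧ ∀ x ∈ K, ‖G.curveGrad u x‖ ≤ T := by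
  choose C hC h using fun j : G.HIndex => hu.exists_curveDeriv_bound hr j.2 hK
  refine ⟨√(∑ j, C j ^ 2) + 1, by positivity, fun x hx => ?_⟩
  rw [EuclideanSpace.norm_eq]
  refine (Real.sqrt_le_sqrt (Finset.sum_le_sum fun j _ => ?_)).trans (by linarith)
  exact pow_le_pow_left₀ (norm_nonneg _) (h j x hx) 2

lemma IsLipLoc.ae_curveDifferentiableAt_all (hr : G.IsHomogeneousNorm r) {u : (Fin n → ℝ) → ℝ}
    (hu : G.IsLipLoc r u) : ∀ᵐ x, ∀ j : G.HIndex, G.CurveDifferentiableAt j.1 u x :=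
  ae_all_iff.2 fun j => hu.ae_curveDifferentiableAt hr j.2

lemma CurveDifferentiableAt.hasDerivAt_comp {j : Fin n} {u : (Fin n → ℝ) → ℝ} {x : Fin n → ℝ}
    (hu : G.CurveDifferentiableAt j u x) {h : ℝ → ℝ} {h' : ℝ} (hh : HasDerivAt h h' (u x)) :
    HasDerivAt (fun t => h (u (G.mul x (G.expCurve j t)))) (h' * G.curveDeriv j u x) 0 := by
  have h1 : HasDerivAt h h' (u (G.mul x (G.expCurve j 0))) := by rwa [mul_expCurve_zero]
  exact h1.comp (0 : ℝ) hu.hasDerivAt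

lemma curveDifferentiableAt_of_differentiable {j : Fin n} {ψ : (Fin n → ℝ) → ℝ}
    (hψ : Differentiable ℝ ψ) (x : Fin n → ℝ) : G.CurveDifferentiableAt j ψ x :=
  (hasDerivAt_comp_expCurve_of_differentiable hψ x).differentiableAt

/-- Gradient of the test function `ψ ^ (κ + 1) * h(u)`. -/
lemma curveGrad_pow_mul_comp {u ψ : (Fin n → ℝ) → ℝ} {x : Fin n → ℝ}
    (hu : ∀ j : G.HIndex, G.CurveDifferentiableAt j.1 u x) (hψ : Differentiable ℝ ψ)
    {h : ℝ → ℝ} {h' : ℝ} (hh : HasDerivAt h h' (u x)) (κ : ℕ) :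
    G.curveGrad (fun x => ψ x ^ (κ + 1) * h (u x)) x =
      ((κ + 1) * ψ x ^ κ * h (u x)) • G.curveGrad ψ x + (ψ x ^ (κ + 1) * h') • G.curveGrad u x := by
  ext j
  have h1 := (hu j).hasDerivAt_comp hh
  have h2 := (curveDifferentiableAt_of_differentiable (G := G) (j := j.1) hψ x).hasDerivAt_comp
    (h := fun s => s ^ (κ + 1)) (hasDerivAt_pow (κ + 1) (ψ x))
  have h3 := (h2.mul h1).deriv
  simp only [mul_expCurve_zero] at h3
  simp only [curveGrad, PiLp.add_apply, PiLp.smul_apply, smul_eq_mul]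
  refine h3.trans ?_
  push_cast
  ring

lemma integrable_of_bounded_of_eq_zero {F : (Fin n → ℝ) → ℝ} {K : Set (Fin n → ℝ)}
    (hK : IsCompact K) (hF : AEStronglyMeasurable F volume) {M : ℝ} (hM : ∀ x ∈ K, |F x| ≤ M)
    (h0 : ∀ x, x ∉ K → F x = 0) : Integrable F := by
  have h1 : IntegrableOn F K :=
    Measure.integrableOn_of_bounded (M := M) hK.measure_lt_top.ne hF
      ((ae_restrict_iff' hK.measurableSet).2 (Eventually.of_forall fun x hx => hM x hx))
  exact h1.integrable_of_forall_notMem_eq_zero fun x hx => h0 x hx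

/-- Testing the inequality with `ψ ^ (κ + 1) * h(u)`: if the cut-off term is pointwise absorbed up
to an error `E`, the diffusion term has integral at most `2 * E * |supp ψ|`. -/
lemma IsWeakSubsolution.integral_energy_le (hr : G.IsHomogeneousNorm r) {φ : ℝ → ℝ} {p : ℝ}
    (hφ : IsWeaklyCoercive φ p) {b : (Fin n → ℝ) → ℝ} (hb : Continuous b) {f : ℝ → ℝ}
    (hf : Continuous f) {l : ℝ → ℝ} (hl : ContinuousOn l (Set.Ici 0)) {u : (Fin n → ℝ) → ℝ}
    (hu : G.IsWeakSubsolution r φ b f l u) {h h' : ℝ → ℝ} (hh : ∀ s, HasDerivAt h (h' s) s)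
    (hh' : Continuous h') (h_nonneg : ∀ s, 0 ≤ h s)
    {ψ : (Fin n → ℝ) → ℝ} (hψ : ContDiff ℝ (⊤ : ℕ∞) ψ) (hψc : HasCompactSupport ψ)
    (hψ0 : ∀ x, 0 ≤ ψ x) {κ : ℕ} (hκ : κ ≠ 0) {E : ℝ}
    (hE : ∀ x ∈ tsupport ψ, (κ + 1) * ψ x ^ κ * h (u x) * φ ‖G.curveGrad u x‖ * ‖G.curveGrad ψ x‖ ≤
      1 / 2 * (ψ x ^ (κ + 1) * h' (u x) * φ ‖G.curveGrad u x‖ * ‖G.curveGrad u x‖) +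
      b x * f (u x) * l ‖G.curveGrad u x‖ * (ψ x ^ (κ + 1) * h (u x)) + E) :
    Integrable (fun x => ψ x ^ (κ + 1) * h' (u x) * φ ‖G.curveGrad u x‖ * ‖G.curveGrad u x‖) ∧
    ∫ x, ψ x ^ (κ + 1) * h' (u x) * φ ‖G.curveGrad u x‖ * ‖G.curveGrad u x‖ ≤
      2 * E * volume.real (tsupport ψ) := by
  obtain ⟨hLip, htest⟩ := hu
  have hcont := hLip.continuous hr
  have hψcont := hψ.continuous
  have hhcont : Continuous h := continuous_iff_continuousAt.2 fun s => (hh s).continuousAt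
  have hh1 : ContDiff ℝ 1 h := contDiff_one_iff_deriv.2
    ⟨fun s => (hh s).differentiableAt, by simpa only [funext fun s => (hh s).deriv] using hh'⟩
  have hψL := isLipLoc_of_contDiff hr hψ
  have hφ0 : ∀ t, 0 ≤ t → 0 ≤ φ t := fun t ht => by
    rcases ht.eq_or_lt with rfl | ht
    · rw [hφ.zero]
    · exact (hφ.pos t ht).le
  -- the test function
  set η : (Fin n → ℝ) → ℝ := fun x => ψ x ^ (κ + 1) * h (u x)
  have hηL : G.IsLipLoc r η :=
    (hψL.comp hr (h := fun s => s ^ (κ + 1))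
      ((contDiff_id.pow (κ + 1)).locallyLipschitz (𝕂 := ℝ))).mul hr
      (hLip.comp hr hh1.locallyLipschitz)
  have hηc : HasCompactSupport η := by
    refine HasCompactSupport.mul_right (f := fun x => ψ x ^ (κ + 1)) ?_
    exact hψc.comp_left (g := fun s => s ^ (κ + 1)) (by simp)
  have hη0 : ∀ x, 0 ≤ η x := fun x => mul_nonneg (pow_nonneg (hψ0 x) _) (h_nonneg _)
  have hineq := htest η (hηL.isLipC hr hηc) hη0
  -- the three terms
  set g := fun x => ‖G.curveGrad u x‖ with hg
  set K := tsupport ψ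
  have hK : IsCompact K := hψc
  have hgm : Measurable g := (measurable_curveGrad hcont).norm
  -- `φ` and `l` are only continuous on `[0, ∞)`, hence the extension `s ↦ F (max s 0)`
  have hcomp : ∀ F : ℝ → ℝ, ContinuousOn F (Ici 0) → Measurable fun x => F (g x) := fun F hF => by
    have h1 : Continuous fun s => F (max s 0) :=
      hF.comp_continuous (by fun_prop) fun s => mem_Ici.2 (le_max_right _ _)
    have h2 : (fun x => F (g x)) = fun x => F (max (g x) 0) := by
      ext x; rw [max_eq_left (norm_nonneg _)]
    rw [h2]; exact h1.measurable.comp hgm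
  obtain ⟨T, hT, hgT⟩ := hLip.exists_curveGrad_bound hr hK
  obtain ⟨T', hT', hψT⟩ := hψL.exists_curveGrad_bound hr hK
  have hbd : ∀ F : ℝ → ℝ, ContinuousOn F (Ici 0) → ∃ B, 0 ≤ B ∧ ∀ x ∈ K, |F (g x)| ≤ B := by
    intro F hF
    obtain ⟨B, hB⟩ := (isCompact_Icc (a := (0 : ℝ)) (b := T)).exists_bound_of_continuousOn
      (hF.mono fun s hs => hs.1)
    exact ⟨B, (norm_nonneg _).trans (hB 0 ⟨le_rfl, hT.le⟩),
      fun x hx => hB _ ⟨norm_nonneg _, hgT x hx⟩⟩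
  have hbdc : ∀ F : (Fin n → ℝ) → ℝ, Continuous F → ∃ B, 0 ≤ B ∧ ∀ x ∈ K, |F x| ≤ B := by
    intro F hF
    obtain ⟨B, hB⟩ := hK.exists_bound_of_continuousOn hF.continuousOn
    exact ⟨max B 0, le_max_right _ _, fun x hx => (hB x hx).trans (le_max_left _ _)⟩
  obtain ⟨Bφ, hBφ0, hBφ⟩ := hbd φ hφ.continuousOn
  obtain ⟨Bl, hBl0, hBl⟩ := hbd l hl
  have hpow0 : ∀ x, x ∉ K → ∀ m : ℕ, m ≠ 0 → ψ x ^ m = 0 := fun x hx m hm => by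
    rw [image_eq_zero_of_notMem_tsupport hx, zero_pow hm]
  set A₁ := fun x => ψ x ^ (κ + 1) * h' (u x) * φ (g x) * g x
  set A₂ := fun x => (κ + 1) * ψ x ^ κ * h (u x) *
    (φ (g x) / g x * inner ℝ (G.curveGrad u x) (G.curveGrad ψ x))
  set A₃ := fun x => b x * f (u x) * l (g x) * η x
  -- where `∇₀u = 0` the quotient `φ(0) / 0` is `0`, and the bound still holds because `φ 0 = 0`
  have hinner : ∀ x, |φ (g x) / g x * inner ℝ (G.curveGrad u x) (G.curveGrad ψ x)| ≤
      φ (g x) * ‖G.curveGrad ψ x‖ := by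
    intro x
    rw [abs_mul, abs_div, abs_of_nonneg (hφ0 _ (norm_nonneg _)), abs_of_nonneg (norm_nonneg _)]
    rcases (norm_nonneg (G.curveGrad u x)).eq_or_lt with h0 | h0
    · have h1 : ‖G.curveGrad u x‖ = 0 := h0.symm
      have h2 : g x = 0 := h1
      simp [h1, h2, hφ.zero]
    · calc _ ≤ φ (g x) / g x * (g x * ‖G.curveGrad ψ x‖) := by
            have := hφ0 _ (norm_nonneg (G.curveGrad u x))
            gcongr
            exact abs_real_inner_le_norm _ _
        _ = _ := by
            have : g x ≠ 0 := h0.ne'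
            field_simp
  have hi₁ : Integrable A₁ := by
    obtain ⟨B, hB0, hB⟩ := hbdc (fun x => ψ x ^ (κ + 1) * h' (u x)) (by fun_prop)
    refine integrable_of_bounded_of_eq_zero hK (M := B * Bφ * T) ?_ (fun x hx => ?_) fun x hx => ?_
    · have h1 : Measurable fun x => ψ x ^ (κ + 1) * h' (u x) :=
        Continuous.measurable (by fun_prop)
      exact ((h1.mul (hcomp φ hφ.continuousOn)).mul hgm).aestronglyMeasurable
    · simp only [A₁]
      rw [abs_mul, abs_mul]
      have h1 := hB x hx
      have h2 := hBφ x hx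
      have h3 : |g x| ≤ T := by rw [abs_of_nonneg (norm_nonneg _)]; exact hgT x hx
      gcongr
    · simp only [A₁, hpow0 x hx _ (Nat.succ_ne_zero κ)]; simp
  have hi₂ : Integrable A₂ := by
    obtain ⟨B, hB0, hB⟩ := hbdc (fun x => (κ + 1) * ψ x ^ κ * h (u x)) (by fun_prop)
    refine integrable_of_bounded_of_eq_zero hK (M := B * (Bφ * T')) ?_ (fun x hx => ?_)
      fun x hx => ?_
    · have h1 : Measurable fun x => (κ + 1) * ψ x ^ κ * h (u x) :=
        Continuous.measurable (by fun_prop)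
      have h2 : Measurable fun x => inner ℝ (G.curveGrad u x) (G.curveGrad ψ x) :=
        (measurable_curveGrad hcont).inner (measurable_curveGrad hψcont)
      exact (h1.mul (((hcomp φ hφ.continuousOn).div hgm).mul h2)).aestronglyMeasurable
    · simp only [A₂]
      rw [abs_mul]
      have h1 := hB x hx
      have h2 := (le_abs_self _).trans (hBφ x hx)
      have h3 := hψT x hx
      refine mul_le_mul h1 ((hinner x).trans ?_) (abs_nonneg _) hB0
      gcongr
    · simp only [A₂, hpow0 x hx _ hκ]; simp
  have hi₃ : Integrable A₃ := by
    obtain ⟨B, hB0, hB⟩ := hbdc (fun x => b x * f (u x)) (by fun_prop)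
    obtain ⟨B', hB'0, hB'⟩ := hbdc η (hηL.continuous hr)
    refine integrable_of_bounded_of_eq_zero hK (M := B * Bl * B') ?_ (fun x hx => ?_) fun x hx => ?_
    · have h1 : Measurable fun x => b x * f (u x) := Continuous.measurable (by fun_prop)
      exact ((h1.mul (hcomp l hl)).mul (hηL.continuous hr).measurable).aestronglyMeasurable
    · simp only [A₃]
      rw [abs_mul, abs_mul]
      have h1 := hB x hx
      have h2 := hBl x hx
      have h3 := hB' x hx
      gcongr
    · simp only [A₃, η, hpow0 x hx _ (Nat.succ_ne_zero κ)]; simp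
  have hgrad_u := hLip.hgrad_ae_eq hr
  have e₁ : G.energyPairing φ u η = ∫ x, (A₁ x + A₂ x) := by
    refine integral_congr_ae ?_
    filter_upwards [hgrad_u, hηL.hgrad_ae_eq hr,
      hLip.ae_curveDifferentiableAt_all hr] with x h1 h2 h3
    rw [h1, h2, curveGrad_pow_mul_comp h3 (hψ.differentiable (by simp)) (hh (u x)), inner_add_right,
      inner_smul_right, inner_smul_right, real_inner_self_eq_norm_sq]
    simp only [A₁, A₂, hg]
    rcases (norm_nonneg (G.curveGrad u x)).eq_or_lt with h0 | h0
    · simp [← h0]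
    · field_simp
      ring
  have e₂ : G.sourcePairing b f l u η = ∫ x, A₃ x := by
    refine integral_congr_ae ?_
    filter_upwards [hgrad_u] with x h1
    simp only [h1, A₃, hg]
  rw [e₁, e₂] at hineq
  have hiE : Integrable (K.indicator fun _ => E) :=
    (integrable_indicator_iff hK.measurableSet).2 (integrableOn_const hK.measure_lt_top.ne)
  have hpt : ∀ x, 1 / 2 * A₁ x ≤ A₁ x + A₂ x + A₃ x + K.indicator (fun _ => E) x := by
    intro x
    by_cases hx : x ∈ K
    · rw [indicator_of_mem hx]
      have h1 := hE x hx
      have h2 := neg_le_of_abs_le (hinner x)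
      have h3 : 0 ≤ (κ + 1) * ψ x ^ κ * h (u x) :=
        mul_nonneg (mul_nonneg (by positivity) (pow_nonneg (hψ0 x) _)) (h_nonneg _)
      have h4 := mul_le_mul_of_nonneg_left h2 h3
      simp only [A₁, A₂, A₃, η, hg] at *
      linarith
    · rw [indicator_of_notMem hx]
      simp only [A₁, A₂, A₃, η, hpow0 x hx _ hκ, hpow0 x hx _ (Nat.succ_ne_zero κ)]
      simp
  have hint := integral_mono (hi₁.const_mul (1 / 2)) (((hi₁.add hi₂).add hi₃).add hiE) hpt
  simp only [Pi.add_apply] at hint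
  have s1 : ∫ x, (A₁ x + A₂ x + A₃ x + K.indicator (fun _ => E) x) =
      (∫ x, (A₁ x + A₂ x)) + (∫ x, A₃ x) + ∫ x, K.indicator (fun _ => E) x := by
    rw [← integral_add (f := fun x => A₁ x + A₂ x) (hi₁.add hi₂) hi₃,
      ← integral_add (f := fun x => A₁ x + A₂ x + A₃ x) ((hi₁.add hi₂).add hi₃) hiE]
  have hvol : ∫ x, K.indicator (fun _ => E) x = volume.real K * E := by
    rw [integral_indicator hK.measurableSet, setIntegral_const]; rfl
  refine ⟨hi₁, ?_⟩
  rw [integral_const_mul] at hint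
  change ∫ x, A₁ x ≤ _
  rw [hvol] at s1
  linarith

/-! ### Cut-off functions at scale `R` -/

lemma curveGrad_comp_dilation (ψ : (Fin n → ℝ) → ℝ) {S : ℝ} (hS : 0 < S) (x : Fin n → ℝ) :
    G.curveGrad (fun x => ψ (anisoDilation G.weight S x)) x =
      S • G.curveGrad ψ (anisoDilation G.weight S x) := by
  ext j
  simp only [curveGrad, PiLp.smul_apply, curveDeriv, G.dilation_mul S hS,
    G.anisoDilation_expCurve j.2 hS]
  have := deriv_comp_mul_left S
    (fun t => ψ (G.mul (anisoDilation G.weight S x) (G.expCurve j.1 t))) 0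
  simpa using this

/-- Cut-off functions adapted to the dilations: the support has volume of the order of `R ^ Q`,
where `Q` is the homogeneous dimension, and the horizontal gradient is of the order of `1 / R`. -/
lemma exists_cutoff (hr : G.IsHomogeneousNorm r) :
    ∃ L M V : ℝ, 0 < L ∧ 0 < M ∧ 0 < V ∧ ∀ R : ℝ, 1 ≤ R → ∃ ψ : (Fin n → ℝ) → ℝ,
      ContDiff ℝ (⊤ : ℕ∞) ψ ∧ HasCompactSupport ψ ∧ (∀ x, 0 ≤ ψ x) ∧ (∀ x, ψ x ≤ 1) ∧
      (∀ x, ‖x‖ ≤ R → ψ x = 1) ∧ (∀ x, ‖G.curveGrad ψ x‖ ≤ L / R) ∧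
      (∀ x ∈ tsupport ψ, 1 + r x ≤ M * R) ∧
      volume.real (tsupport ψ) ≤ V * R ^ (∑ i, G.weight i) := by
  let β : ContDiffBump (0 : Fin n → ℝ) := ⟨1, 2, one_pos, one_lt_two⟩
  have hβ : ContDiff ℝ (⊤ : ℕ∞) β := β.contDiff
  obtain ⟨L, hL, hβL⟩ := (isLipLoc_of_contDiff hr hβ).exists_curveGrad_bound hr β.hasCompactSupport
  have hβL' : ∀ x, ‖G.curveGrad β x‖ ≤ L := fun x => by
    by_cases hx : x ∈ tsupport β
    · exact hβL x hx
    · have : G.curveGrad β x = 0 := by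
        ext j
        have h1 := (hasDerivAt_comp_expCurve_of_differentiable (G := G) (j := j.1)
          (hβ.differentiable (by simp)) x).deriv
        rw [fderiv_of_notMem_tsupport (𝕜 := ℝ) hx] at h1
        simpa [curveGrad, curveDeriv] using h1
      rw [this, norm_zero]; exact hL.le
  obtain ⟨M, hM⟩ := (isCompact_closedBall (0 : Fin n → ℝ) 2).exists_bound_of_continuousOn
    hr.continuous.continuousOn
  have hM0 : 0 ≤ M := (norm_nonneg _).trans (hM 0 (by simp))
  refine ⟨L, 1 + M, 4 ^ n, hL, by positivity, by positivity, fun R hR => ?_⟩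
  have hR0 : 0 < R := by linarith
  have hRi : 0 < R⁻¹ := inv_pos.2 hR0
  set δ := anisoDilationCLM G.weight R⁻¹ with hδ
  have hδx : ∀ x i, δ x i = (R ^ G.weight i)⁻¹ * x i := fun x i => by
    simp [δ, anisoDilation]
  set S : Set (Fin n → ℝ) := δ ⁻¹' Metric.closedBall 0 2
  have hSclosed : IsClosed S := Metric.isClosed_closedBall.preimage δ.continuous
  set bd : Fin n → ℝ := fun i => 2 * R ^ G.weight i with hbd
  have hSsub : S ⊆ Icc (-bd) bd := by
    intro x hx
    have h1 : ∀ i, |x i| ≤ bd i := fun i => by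
      have h2 := (norm_le_pi_norm (δ x) i).trans (mem_closedBall_zero_iff.1 hx)
      rw [hδx, norm_mul, Real.norm_of_nonneg (by positivity), Real.norm_eq_abs,
        inv_mul_le_iff₀ (by positivity)] at h2
      simp only [hbd]; linarith
    exact ⟨fun i => (abs_le.1 (h1 i)).1, fun i => (abs_le.1 (h1 i)).2⟩
  have hScompact : IsCompact S := isCompact_Icc.of_isClosed_subset hSclosed hSsub
  have hsupp : tsupport (fun x => β (δ x)) ⊆ S := by
    refine closure_minimal (fun x hx => ?_) hSclosed
    have : δ x ∈ Function.support β := hx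
    rw [β.support_eq] at this
    exact Metric.ball_subset_closedBall this
  refine ⟨fun x => β (δ x), hβ.comp δ.contDiff, ?_, fun x => β.nonneg, fun x => β.le_one,
    fun x hx => ?_, fun x => ?_, fun x hx => ?_, ?_⟩
  · exact hScompact.of_isClosed_subset (isClosed_tsupport _) hsupp
  · apply β.one_of_mem_closedBall
    rw [mem_closedBall_zero_iff, pi_norm_le_iff_of_nonneg (by simp [β])]
    intro i
    rw [hδx, norm_mul, Real.norm_of_nonneg (by positivity), inv_mul_le_iff₀ (by positivity)]
    calc ‖x i‖ ≤ R := (norm_le_pi_norm x i).trans hx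
      _ = R ^ 1 := (pow_one R).symm
      _ ≤ R ^ G.weight i := pow_le_pow_right₀ hR (G.weight_pos i)
      _ = R ^ G.weight i * 1 := (_root_.mul_one _).symm
  · have h1 : G.curveGrad (fun x => β (δ x)) x = R⁻¹ • G.curveGrad β (δ x) := by
      have := curveGrad_comp_dilation (G := G) β hRi x
      simpa only [δ, anisoDilationCLM_apply] using this
    rw [h1, norm_smul, Real.norm_of_nonneg hRi.le, div_eq_inv_mul]
    exact mul_le_mul_of_nonneg_left (hβL' _) hRi.le
  · have h1 := hM (δ x) (hsupp hx)
    rw [Real.norm_of_nonneg (hr.nonneg _), hδ, anisoDilationCLM_apply, hr.dilation _ hRi,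
      inv_mul_le_iff₀ hR0] at h1
    nlinarith
  · calc volume.real (tsupport fun x => β (δ x)) ≤ volume.real (Icc (-bd) bd) :=
          measureReal_mono (hsupp.trans hSsub) isCompact_Icc.measure_lt_top.ne
      _ = ∏ i, (bd i - (-bd) i) := by
          rw [measureReal_def, Real.volume_Icc_pi_toReal]
          intro i; simp only [hbd, Pi.neg_apply]
          have : 0 < R ^ G.weight i := by positivity
          linarith
      _ = ∏ i, (4 * R ^ G.weight i) := Finset.prod_congr rfl fun i _ => by
          simp only [hbd, Pi.neg_apply]; ring
      _ ≤ _ := by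
          rw [Finset.prod_mul_distrib, Finset.prod_pow_eq_pow_sum]; simp

/-! ### The Liouville alternative -/

/-- If `f(u)` dominates `(u - γ) ^ ω` where `u > γ`, then a subsolution `u` does not exceed `γ`,
unless it is constant: the energy estimate at scale `R` shows that the horizontal gradient of
`(u - γ)₊ ^ q` vanishes. -/
theorem IsWeakSubsolution.le_or_eq_const (hr : G.IsHomogeneousNorm r) {p : ℝ} (hp : 1 < p)
    {φ : ℝ → ℝ} (hφ : IsWeaklyCoercive φ p) {b : (Fin n → ℝ) → ℝ} (hb : Continuous b)
    (hb_pos : ∀ x, 0 < b x) {f : ℝ → ℝ} (hf : Continuous f) {l : ℝ → ℝ}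
    (hl : ContinuousOn l (Set.Ici 0)) (hl_pos : ∀ t, 0 < t → 0 < l t) {μ χ ω : ℝ}
    (hχp : χ ≤ p - 1) (hμ : μ < p - χ) (hω : p - 1 - χ < ω) {C : ℝ} (hC : 0 < C)
    (hb_lower : ∀ x, C * (1 + r x) ^ (-μ) ≤ b x)
    (hl_lower : ∀ t, 0 < t → C * (φ t / t ^ (p - 1 - χ)) ≤ l t)
    {u : (Fin n → ℝ) → ℝ} (hu : G.IsWeakSubsolution r φ b f l u) {γ c : ℝ} (hc : 0 < c)
    (hfu : ∀ x, γ < u x → c * (u x - γ) ^ ω ≤ f (u x)) :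
    (∀ x, u x ≤ γ) ∨ ∃ c₀, ∀ x, u x = c₀ := by
  obtain ⟨C', hC', hgrowth⟩ := hφ.growth
  obtain ⟨L, M, V, hL, hM, hV, hcut⟩ := exists_cutoff hr
  have hLip := hu.1
  set a := p - 1 - χ
  have ha : 0 ≤ a := by linarith
  set Q := ∑ i, G.weight i
  -- since `1 + r ≥ 1`, the exponent `μ` may be replaced by its positive part
  set μ₀ := max μ 0
  have hμ₀a : μ₀ < 1 + a := max_lt (by linarith) (by linarith)
  have hσ : 0 < ω - a := by linarith
  -- the power of `u` beats the volume growth, and the power of the cut-off beats the power of `u`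
  obtain ⟨m, hm⟩ := exists_nat_ge ((Q + 1) * (ω - a) / (1 + a - μ₀))
  have hD : ((Q : ℝ) + 1) ≤ p + (1 + a - μ₀) * (((m + 2 : ℕ) + p - 1) / (ω - a)) := by
    have h1 : 0 < 1 + a - μ₀ := by linarith
    rw [div_le_iff₀ h1] at hm
    have h2 : ((Q : ℝ) + 1) ≤ (1 + a - μ₀) * (((m + 2 : ℕ) + p - 1) / (ω - a)) := by
      rw [← mul_div_assoc, le_div_iff₀ hσ]
      push_cast
      nlinarith
    linarith
  obtain ⟨k, hk⟩ := exists_nat_ge (p + (1 + a) * (((m + 2 : ℕ) + p - 1) / (ω - a)))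
  have hk2 : 2 ≤ k := by
    have : 0 ≤ (1 + a) * (((m + 2 : ℕ) + p - 1) / (ω - a)) := by
      have h1 : (0 : ℝ) ≤ (m + 2 : ℕ) := Nat.cast_nonneg _
      have h2 : 0 ≤ ((m + 2 : ℕ) + p - 1) / (ω - a) := div_nonneg (by linarith) hσ.le
      positivity
    have : (1 : ℝ) < k := by linarith
    have : 1 < k := by exact_mod_cast this
    omega
  obtain ⟨κ, rfl⟩ : ∃ κ, k = κ + 1 := ⟨k - 1, by omega⟩
  have hκ : κ ≠ 0 := by omega
  obtain ⟨K, hK, habs⟩ := exists_cutoff_absorption (k := κ + 1) (q := m + 2) (c := C * c * C)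
    (μ := μ₀) hp ha hω (by positivity) hC' hL hM (by omega) hk hD
  set h : ℝ → ℝ := fun s => max (s - γ) 0 ^ (m + 2) with hh_def
  set h' : ℝ → ℝ := fun s => ((m + 2 : ℕ) : ℝ) * max (s - γ) 0 ^ (m + 1) with hh'_def
  have hh : ∀ s, HasDerivAt h (h' s) s := hasDerivAt_max_pow γ m
  have hh' : Continuous h' := by fun_prop
  have h'_nonneg : ∀ s, 0 ≤ h' s := fun s => by positivity
  have hφ0 : ∀ t, 0 ≤ t → 0 ≤ φ t := fun t ht => by
    rcases ht.eq_or_lt with rfl | ht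
    · rw [hφ.zero]
    · exact (hφ.pos t ht).le
  have hl0 : ∀ t, 0 ≤ t → 0 ≤ l t := fun t ht => by
    have hcl : t ∈ closure (Ioi (0 : ℝ)) := by rw [closure_Ioi]; exact ht
    refine ContinuousWithinAt.closure_le (f := fun _ => 0) (g := l) hcl continuousWithinAt_const
      ((hl t ht).mono Ioi_subset_Ici_self) fun s hs => (hl_pos s hs).le
  set F : (Fin n → ℝ) → ℝ := fun x => h' (u x) * φ ‖G.curveGrad u x‖ * ‖G.curveGrad u x‖ with hF
  have hF0 : ∀ x, 0 ≤ F x := fun x =>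
    mul_nonneg (mul_nonneg (h'_nonneg _) (hφ0 _ (norm_nonneg _))) (norm_nonneg _)
  have hball : ∀ N : ℝ, ∀ R, 1 ≤ R → N ≤ R →
      Integrable ((Metric.closedBall 0 N).indicator F) ∧
      ∫ x, (Metric.closedBall 0 N).indicator F x ≤ 2 * K * V * R⁻¹ := by
    intro N R hR hNR
    have hR0 : 0 < R := by linarith
    obtain ⟨ψ, hψ, hψc, hψ0, hψ1, hψR, hψL, hψr, hψV⟩ := hcut R hR
    have hbound : ∀ x, γ < u x → ∀ t, 0 < t → x ∈ tsupport ψ →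
        C * c * C * (M * R) ^ (-μ₀) * (u x - γ) ^ ω * (φ t / t ^ a) ≤ b x * f (u x) * l t := by
      intro x hx t ht hxs
      have h1 : C * (M * R) ^ (-μ₀) ≤ b x := by
        refine le_trans ?_ (hb_lower x)
        have hr1 : 1 ≤ 1 + r x := by linarith [hr.nonneg x]
        gcongr
        calc (M * R) ^ (-μ₀) ≤ (1 + r x) ^ (-μ₀) :=
              Real.rpow_le_rpow_of_nonpos (by linarith) (hψr x hxs)
                (neg_nonpos.2 (le_max_right _ _))
          _ ≤ (1 + r x) ^ (-μ) :=
              Real.rpow_le_rpow_of_exponent_le hr1 (neg_le_neg (le_max_left _ _))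
      have h2 := hfu x hx
      have h3 := hl_lower t ht
      have hv : 0 < u x - γ := by linarith
      have hφt := hφ.pos t ht
      calc _ = (C * (M * R) ^ (-μ₀)) * (c * (u x - γ) ^ ω) * (C * (φ t / t ^ a)) := by ring
        _ ≤ b x * f (u x) * l t := by
          have := (hb_pos x).le
          have : 0 ≤ c * (u x - γ) ^ ω := by positivity
          have : 0 ≤ f (u x) := this.trans h2
          gcongr
    obtain ⟨hint, hle⟩ := hu.integral_energy_le hr hφ hb hf hl hh hh' (fun s => by positivity)
      hψ hψc hψ0 hκ (E := K * R ^ (-((Q : ℝ) + 1))) (by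
        intro x hx
        have hE : 0 ≤ K * R ^ (-((Q : ℝ) + 1)) := by positivity
        rcases le_or_gt (u x) γ with hux | hux
        · simp only [hh_def, hh'_def, max_eq_right (sub_nonpos.2 hux)]
          simpa using hE
        have hψk := pow_nonneg (hψ0 x) (κ + 1)
        have hfpos : 0 ≤ f (u x) := by
          have : 0 < u x - γ := by linarith
          exact le_trans (by positivity) (hfu x hux)
        have hhpos : 0 ≤ h (u x) := by positivity
        rcases (norm_nonneg (G.curveGrad u x)).eq_or_lt with ht | ht
        · rw [← ht, hφ.zero]
          have := mul_nonneg (mul_nonneg (mul_nonneg (hb_pos x).le hfpos) (hl0 0 le_rfl))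
            (mul_nonneg hψk hhpos)
          simp only [MulZeroClass.mul_zero, MulZeroClass.zero_mul, _root_.zero_add]
          linarith
        rcases (hψ0 x).eq_or_lt with hψx | hψx
        · rw [← hψx]; simpa [hκ] using hE
        have key := habs R (ψ x) (u x - γ) _ (φ ‖G.curveGrad u x‖) ‖G.curveGrad ψ x‖ hR hψx (hψ1 x)
          (by linarith) ht (hφ0 _ ht.le) (hgrowth _ ht) (norm_nonneg _) (hψL x)
        have hsrc := mul_le_mul_of_nonneg_right (hbound x hux _ ht hx)
          (mul_nonneg hψk hhpos)
        simp only [hh_def, hh'_def, max_eq_left (sub_nonneg.2 hux.le)] at hsrc ⊢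
        push_cast at key ⊢
        linarith)
    have hind : (Metric.closedBall 0 N).indicator F = (Metric.closedBall 0 N).indicator fun x =>
        ψ x ^ (κ + 1) * h' (u x) * φ ‖G.curveGrad u x‖ * ‖G.curveGrad u x‖ := by
      refine indicator_congr fun x hx => ?_
      rw [hψR x ((mem_closedBall_zero_iff.1 hx).trans hNR)]
      simp [hF]
    have hi : Integrable ((Metric.closedBall 0 N).indicator F) := by
      rw [hind]; exact hint.indicator Metric.isClosed_closedBall.measurableSet
    refine ⟨hi, ?_⟩
    calc ∫ x, (Metric.closedBall 0 N).indicator F x ≤ _ := by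
          refine integral_mono hi hint fun x => ?_
          rw [hind]
          refine indicator_le_self' (fun y _ => ?_) x
          have e : ψ y ^ (κ + 1) * h' (u y) * φ ‖G.curveGrad u y‖ * ‖G.curveGrad u y‖ =
            ψ y ^ (κ + 1) * F y := by simp only [hF]; ring
          rw [e]; exact mul_nonneg (pow_nonneg (hψ0 y) _) (hF0 y)
      _ ≤ 2 * (K * R ^ (-((Q : ℝ) + 1))) * volume.real (tsupport ψ) := hle
      _ ≤ 2 * (K * R ^ (-((Q : ℝ) + 1))) * (V * R ^ Q) := by gcongr
      _ = 2 * K * V * R⁻¹ := by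
          have : R ^ (-((Q : ℝ) + 1)) * R ^ Q = R⁻¹ := by
            rw [← Real.rpow_natCast, ← Real.rpow_add hR0, ← Real.rpow_neg_one]; congr 1; ring
          rw [← this]; ring
  have hae : ∀ᵐ x, F x = 0 := by
    have h1 : ∀ N : ℕ, ∀ᵐ x, (Metric.closedBall 0 (N : ℝ)).indicator F x = 0 := by
      intro N
      have h0 : ∫ x, (Metric.closedBall 0 (N : ℝ)).indicator F x = 0 := by
        refine le_antisymm ?_ (integral_nonneg fun x => indicator_nonneg (fun x _ => hF0 x) x)
        have hlim : Tendsto (fun R : ℝ => 2 * K * V * R⁻¹) atTop (𝓝 0) := by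
          simpa using tendsto_inv_atTop_zero.const_mul (2 * K * V)
        refine ge_of_tendsto hlim ?_
        filter_upwards [eventually_ge_atTop (1 : ℝ), eventually_ge_atTop (N : ℝ)] with R h1 h2
        exact (hball N R h1 h2).2
      exact (integral_eq_zero_iff_of_nonneg (fun x => indicator_nonneg (fun x _ => hF0 x) x)
        (hball N (max 1 N) (le_max_left _ _) (le_max_right _ _)).1).1 h0
    filter_upwards [ae_all_iff.2 h1] with x hx
    obtain ⟨N, hN⟩ := exists_nat_ge ‖x‖
    have := hx N
    rwa [indicator_of_mem (mem_closedBall_zero_iff.2 hN)] at this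
  have hhL : LocallyLipschitz h :=
    ContDiff.locallyLipschitz (𝕂 := ℝ) (contDiff_one_iff_deriv.2
      ⟨fun s => (hh s).differentiableAt, by simpa only [funext fun s => (hh s).deriv] using hh'⟩)
  have hconst := (hLip.comp hr hhL).eq_of_curveDeriv_ae_zero hr (fun j hj => by
    filter_upwards [hae, hLip.ae_curveDifferentiableAt hr hj] with x hx hdiff
    have h1 : G.curveDeriv j (fun x => h (u x)) x = h' (u x) * G.curveDeriv j u x :=
      (hdiff.hasDerivAt_comp (hh (u x))).deriv
    rw [h1]
    rcases eq_or_ne (h' (u x)) 0 with h2 | h2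
    · simp [h2]
    · have h3 : ‖G.curveGrad u x‖ = 0 := by
        by_contra hne
        have ht : 0 < ‖G.curveGrad u x‖ := lt_of_le_of_ne (norm_nonneg _) (Ne.symm hne)
        exact mul_ne_zero (mul_ne_zero h2 (hφ.pos _ ht).ne') ht.ne' hx
      have h4 : G.curveGrad u x ⟨j, hj⟩ = 0 := by rw [norm_eq_zero.1 h3]; rfl
      have h5 : G.curveDeriv j u x = 0 := h4
      simp [h5])
  by_cases hle : ∀ x, u x ≤ γ
  · exact Or.inl hle
  push Not at hle
  obtain ⟨x₀, hx₀⟩ := hle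
  refine Or.inr ⟨u x₀, fun x => ?_⟩
  have h1 := hconst x x₀
  have h2 : max (u x - γ) 0 = max (u x₀ - γ) 0 :=
    (pow_left_inj₀ (le_max_right _ _) (le_max_right _ _) (by omega : m + 2 ≠ 0)).1 h1
  rw [max_eq_left (a := u x₀ - γ) (by linarith)] at h2
  rcases max_choice (u x - γ) 0 with h3 | h3 <;> linarith

/-! ### Consequences for subsolutions and solutions -/

/-- A constant subsolution `c₀` satisfies `f c₀ ≤ 0` when `l 0 > 0`: its horizontal gradient
vanishes, so that testing with a bump function leaves only the source term. -/
lemma IsWeakSubsolution.le_zero_of_const (hr : G.IsHomogeneousNorm r) {φ : ℝ → ℝ}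
    {b : (Fin n → ℝ) → ℝ} (hb : Continuous b) (hb_pos : ∀ x, 0 < b x) {f l : ℝ → ℝ}
    {u : (Fin n → ℝ) → ℝ} (hu : G.IsWeakSubsolution r φ b f l u) {c₀ : ℝ}
    (hc : ∀ x, u x = c₀) (hl0 : 0 < l 0) : f c₀ ≤ 0 := by
  let η : ContDiffBump (0 : Fin n → ℝ) := ⟨1, 2, one_pos, one_lt_two⟩
  have hη : ContDiff ℝ (⊤ : ℕ∞) η := η.contDiff
  have h1 := hu.2 η ((isLipLoc_of_contDiff hr hη).isLipC hr η.hasCompactSupport)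
    fun x => η.nonneg
  have hgrad : ∀ᵐ x, G.hgrad u x = 0 := by
    filter_upwards [hu.1.hgrad_ae_eq hr] with x hx
    rw [hx]; ext j
    simp [curveGrad, curveDeriv, hc]
  have e1 : G.energyPairing φ u η = 0 := by
    refine integral_eq_zero_of_ae ?_
    filter_upwards [hgrad] with x hx
    simp [hx]
  have e2 : G.sourcePairing b f l u η = f c₀ * l 0 * ∫ x, b x * η x := by
    rw [← integral_const_mul]
    refine integral_congr_ae ?_
    filter_upwards [hgrad] with x hx
    simp only [hx, hc, norm_zero]; ring
  have hpos : 0 < ∫ x, b x * η x := by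
    refine Continuous.integral_pos_of_hasCompactSupport_nonneg_nonzero (x := 0)
      (hb.mul η.continuous) η.hasCompactSupport.mul_left
      (fun x => mul_nonneg (hb_pos x).le η.nonneg) ?_
    have : η 0 = 1 := η.one_of_mem_closedBall (Metric.mem_closedBall_self η.rIn_pos.le)
    simpa only [this, _root_.mul_one] using (hb_pos 0).ne'
  rw [e1, e2] at h1
  by_contra! hf
  have : 0 < f c₀ * l 0 * ∫ x, b x * η x := by positivity
  linarith

/-- Liouville property of subsolutions. -/
theorem IsWeakSubsolution.bddAbove_and_le_zero (hr : G.IsHomogeneousNorm r) {p : ℝ} (hp : 1 < p)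
    {φ : ℝ → ℝ} (hφ : IsWeaklyCoercive φ p) {b : (Fin n → ℝ) → ℝ} (hb : Continuous b)
    (hb_pos : ∀ x, 0 < b x) {f : ℝ → ℝ} (hf : Continuous f) {l : ℝ → ℝ}
    (hl : ContinuousOn l (Set.Ici 0)) (hl_pos : ∀ t, 0 < t → 0 < l t) {μ χ ω : ℝ}
    (hχp : χ ≤ p - 1) (hμ : μ < p - χ) (hω : p - 1 - χ < ω) {C : ℝ} (hC : 0 < C)
    (hb_lower : ∀ x, C * (1 + r x) ^ (-μ) ≤ b x)
    (hl_lower : ∀ t, 0 < t → C * (φ t / t ^ (p - 1 - χ)) ≤ l t)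
    {T : ℝ} (hT : ∀ t, T ≤ t → C * t ^ ω ≤ f t)
    {u : (Fin n → ℝ) → ℝ} (hu : G.IsWeakSubsolution r φ b f l u) :
    BddAbove (Set.range u) ∧ (0 < l 0 → f (⨆ x, u x) ≤ 0) ∧
      (l 0 = 0 → (¬ ∃ c, ∀ x, u x = c) → f (⨆ x, u x) ≤ 0) := by
  have key := fun (γ c : ℝ) (hc : 0 < c) (h : ∀ x, γ < u x → c * (u x - γ) ^ ω ≤ f (u x)) =>
    hu.le_or_eq_const hr hp hφ hb hb_pos hf hl hl_pos hχp hμ hω hC hb_lower hl_lower hc h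
  have hω0 : 0 ≤ ω := by linarith
  have hbdd : BddAbove (range u) := by
    rcases key (max T 0) C hC (fun x hx => by
      have h0 : 0 ≤ max T 0 := le_max_right _ _
      refine le_trans ?_ (hT (u x) ((le_max_left T 0).trans hx.le))
      have : 0 ≤ u x - max T 0 := by linarith
      gcongr
      linarith) with h | ⟨c₀, h⟩
    · exact ⟨_, by rintro _ ⟨x, rfl⟩; exact h x⟩
    · exact ⟨c₀, by rintro _ ⟨x, rfl⟩; exact (h x).le⟩
  have hconst : 0 < f (⨆ x, u x) → ∃ c₀, ∀ x, u x = c₀ := by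
    intro hpos
    set S := ⨆ x, u x with hS
    have hle : ∀ x, u x ≤ S := fun x => le_ciSup hbdd x
    obtain ⟨δ, hδ, hball⟩ := Metric.eventually_nhds_iff_ball.1
      (hf.continuousAt.eventually_const_lt (half_lt_self hpos))
    have hδω : 0 < (δ / 2) ^ ω := by positivity
    rcases key (S - δ / 2) (f S / 2 / (δ / 2) ^ ω) (by positivity) (fun x hx => by
      have h1 := hle x
      have h2 : f S / 2 < f (u x) := hball (u x) (by
        rw [Metric.mem_ball, Real.dist_eq, abs_lt]; constructor <;> linarith)
      have h3 : (u x - (S - δ / 2)) ^ ω ≤ (δ / 2) ^ ω :=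
        Real.rpow_le_rpow (by linarith) (by linarith) hω0
      calc _ ≤ f S / 2 / (δ / 2) ^ ω * (δ / 2) ^ ω := by gcongr
        _ = f S / 2 := div_mul_cancel₀ _ hδω.ne'
        _ ≤ f (u x) := h2.le) with h | h
    · have : S ≤ S - δ / 2 := ciSup_le h
      linarith
    · exact h
  refine ⟨hbdd, fun hl0 => ?_, fun _ hne => ?_⟩
  · by_contra! hpos
    obtain ⟨c₀, hc₀⟩ := hconst hpos
    have h1 := hu.le_zero_of_const hr hb hb_pos hc₀ hl0
    have h2 : ⨆ x, u x = c₀ := by simp [hc₀]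
    rw [h2] at hpos
    linarith
  · by_contra! hpos
    exact hne (hconst hpos)

/-- If `u` is a solution for `f`, then `-u` is a solution for `t ↦ -f (-t)`. -/
lemma IsWeakSolution.neg (hr : G.IsHomogeneousNorm r) {φ : ℝ → ℝ} {b : (Fin n → ℝ) → ℝ}
    {f l : ℝ → ℝ} {u : (Fin n → ℝ) → ℝ} (hu : G.IsWeakSolution r φ b f l u) :
    G.IsWeakSolution r φ b (fun t => -f (-t)) l (fun x => -u x) := by
  have hneg := hu.1.neg hr
  have hgrad : ∀ᵐ x, G.hgrad (fun x => -u x) x = -G.hgrad u x := by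
    filter_upwards [hneg.hgrad_ae_eq hr, hu.1.hgrad_ae_eq hr] with x h1 h2
    rw [h1, h2]; ext j
    simp [curveGrad, curveDeriv]
  refine ⟨hneg, fun η hη hη0 => ?_⟩
  have e1 : G.energyPairing φ (fun x => -u x) η = -G.energyPairing φ u η := by
    rw [energyPairing, energyPairing, ← integral_neg]
    refine integral_congr_ae ?_
    filter_upwards [hgrad] with x hx
    simp [hx]
  have e2 : G.sourcePairing b (fun t => -f (-t)) l (fun x => -u x) η =
      -G.sourcePairing b f l u η := by
    rw [sourcePairing, sourcePairing, ← integral_neg]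
    refine integral_congr_ae ?_
    filter_upwards [hgrad] with x hx
    simp [hx]
  rw [e1, e2, hu.2 η hη hη0]

end HomogeneousCarnotGroup

end CarnotLiouville

/-! ### The Liouville theorem -/

theorem mainTheorem1 {n : ℕ} (G : HomogeneousCarnotGroup n)
    (r : (Fin n → ℝ) → ℝ) (hr : G.IsHomogeneousNorm r)
    (p : ℝ) (hp : 1 < p) (φ : ℝ → ℝ) (hφ : IsWeaklyCoercive φ p)
    (b : (Fin n → ℝ) → ℝ) (hb : Continuous b) (hb_pos : ∀ x, 0 < b x)
    (f : ℝ → ℝ) (hf : Continuous f)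
    (l : ℝ → ℝ) (hl : ContinuousOn l (Set.Ici 0)) (hl_pos : ∀ t, 0 < t → 0 < l t)
    (μ χ ω : ℝ) (hχ0 : 0 ≤ χ) (hχp : χ ≤ p - 1) (hμ : μ < p - χ) (hω : p - 1 - χ < ω)
    (C : ℝ) (hC : 0 < C)
    (hb_lower : ∀ x, C * (1 + r x) ^ (-μ) ≤ b x)
    (hl_lower : ∀ t, 0 < t → C * (φ t / t ^ (p - 1 - χ)) ≤ l t) :
    ((∃ T : ℝ, ∀ t, T ≤ t → C * t ^ ω ≤ f t) →
      ∀ u : (Fin n → ℝ) → ℝ, G.IsWeakSubsolution r φ b f l u →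
        BddAbove (Set.range u) ∧
        (0 < l 0 → f (⨆ x, u x) ≤ 0) ∧
        (l 0 = 0 → (¬ ∃ c, ∀ x, u x = c) → f (⨆ x, u x) ≤ 0)) ∧
    ((∃ T : ℝ, ∀ t, T ≤ |t| → C * |t| ^ (ω + 1) ≤ t * f t) →
      ∀ u : (Fin n → ℝ) → ℝ, G.IsWeakSolution r φ b f l u →
        MemLp u ⊤ volume ∧ BddAbove (Set.range u) ∧ BddBelow (Set.range u) ∧
        (0 < l 0 → f (⨆ x, u x) ≤ 0 ∧ 0 ≤ f (⨅ x, u x)) ∧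
        (l 0 = 0 → (¬ ∃ c, ∀ x, u x = c) →
          f (⨆ x, u x) ≤ 0 ∧ 0 ≤ f (⨅ x, u x))) := by
  refine ⟨fun ⟨T, hT⟩ u hu => hu.bddAbove_and_le_zero hr hp hφ hb hb_pos hf hl hl_pos hχp hμ hω hC
    hb_lower hl_lower hT, fun ⟨T, hT⟩ u hu => ?_⟩
  have hsub : G.IsWeakSubsolution r φ b f l u := ⟨hu.1, fun η h1 h2 => (hu.2 η h1 h2).le⟩
  have hneg := hu.neg hr
  have hsub' : G.IsWeakSubsolution r φ b (fun t => -f (-t)) l (fun x => -u x) :=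
    ⟨hneg.1, fun η h1 h2 => (hneg.2 η h1 h2).le⟩
  -- dividing `C * |t| ^ (ω + 1) ≤ t * f t` by `|t|` for `t > 0` and for `t < 0`
  have hpos : ∀ t, max T 1 ≤ t → C * t ^ ω ≤ f t := fun t ht => by
    have h1 : 0 < t := by linarith [le_max_right T 1]
    have h2 := hT t (by rw [abs_of_pos h1]; exact (le_max_left _ _).trans ht)
    rw [abs_of_pos h1, Real.rpow_add h1, Real.rpow_one] at h2
    exact le_of_mul_le_mul_right (by linarith : C * t ^ ω * t ≤ f t * t) h1
  have hpos' : ∀ t, max T 1 ≤ t → C * t ^ ω ≤ -f (-t) := fun t ht => by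
    have h1 : 0 < t := by linarith [le_max_right T 1]
    have h2 := hT (-t) (by rw [abs_neg, abs_of_pos h1]; exact (le_max_left _ _).trans ht)
    rw [abs_neg, abs_of_pos h1, Real.rpow_add h1, Real.rpow_one] at h2
    exact le_of_mul_le_mul_right (by linarith : C * t ^ ω * t ≤ -f (-t) * t) h1
  obtain ⟨hA, hA1, hA2⟩ := hsub.bddAbove_and_le_zero hr hp hφ hb hb_pos hf hl hl_pos hχp hμ hω hC
    hb_lower hl_lower hpos
  obtain ⟨hB, hB1, hB2⟩ := hsub'.bddAbove_and_le_zero hr hp hφ hb hb_pos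
    (hf.comp continuous_neg).neg hl hl_pos hχp hμ hω hC hb_lower hl_lower hpos'
  have hinf : -(⨆ x, -u x) = ⨅ x, u x := by
    rw [iInf, Real.sInf_def, ← Set.image_neg_eq_neg, ← Set.range_comp]; rfl
  change 0 < l 0 → -f (-⨆ x, -u x) ≤ 0 at hB1
  change l 0 = 0 → (¬ ∃ c, ∀ x, -u x = c) → -f (-⨆ x, -u x) ≤ 0 at hB2
  rw [hinf] at hB1 hB2
  obtain ⟨M₁, hM₁⟩ := hA
  obtain ⟨M₂, hM₂⟩ := hB
  have h1 : ∀ x, u x ≤ M₁ := fun x => hM₁ ⟨x, rfl⟩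
  have h2 : ∀ x, -u x ≤ M₂ := fun x => hM₂ ⟨x, rfl⟩
  refine ⟨memLp_top_of_bound (hu.1.continuous hr).aestronglyMeasurable (max M₁ M₂)
    (Filter.Eventually.of_forall fun x => abs_le.2 ⟨by linarith [h2 x, le_max_right M₁ M₂],
      (h1 x).trans (le_max_left _ _)⟩), ⟨M₁, hM₁⟩, ⟨-M₂, ?_⟩,
    fun hl0 => ⟨hA1 hl0, by linarith [hB1 hl0]⟩,
    fun hl0 hne => ⟨hA2 hl0 hne, ?_⟩⟩
  · rintro _ ⟨x, rfl⟩
    linarith [h2 x]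
  · have := hB2 hl0 fun ⟨c, hc⟩ => hne ⟨-c, fun x => by linarith [hc x]⟩
    linarith
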